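/- Affine continuous logic. A Lipschitz language $L$ (of arbitrary cardinality) consists of constant, function and relation symbols, each function symbol $F$ and relation symbol $R$ having a Lipschitz constant $\lambda_F,\lambda_R\ge 0$. An $L$-structure is a nonempty complete metric space $(M,d)$ of diameter at most $1$ with interpretations of the constants by elements of $M$, of each $n$-ary $F$ by a map $M^n\to M$ and of each $n$-ary $R$ by a map $M^n\to[0,1]$ that are $\lambda_F$- resp. $\lambda_R$-Lipschitz for the metric $\sum_{i} d(x_i,y_i)$ on $M^n$. Affine formulas are built from $1$, $d(t_1,t_2)$ and $R(t_1,\dots,t_n)$ ($t_i$ terms) by $\phi+\psi$, $r\phi$ ($r\in\mathbb R$), $\inf_x\phi$ and $\sup_x\phi$, and have real values $\phi^M(\bar a)$ in the obvious way. A theory $T$ is a set of conditions $\sigma\le\eta$ between sentences; it is complete if it has a model and for every sentence $\sigma$ there is a real $r$ with $\sigma^M=r$ in all models $M$ of $T$. For $n\ge 0$, $K_n(T)$ is the convex set of all functionals $p$ on the formulas $\phi(x_1,\dots,x_n)$ (taken up to $T$-equivalence) that are linear, normalized ($p(1)=1$) and positive ($p(\phi)\ge0$ whenever $\phi^M(\bar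 a)\ge 0$ for all models $M$ of $T$ and all $\bar a\in M^n$). Its elements are the (complete) $n$-types of $T$, and a type is extreme if it is an extreme point of $K_n(T)$. A model $M$ omits $p\in K_n(T)$ if there is no $\bar a\in M^n$ with $p(\phi)=\phi^M(\bar a)$ for all $\phi$. A model $M$ of $T$ is extremal if for every $n$ and every $\bar a\in M^n$ the type $\phi\mapsto\phi^M(\bar a)$ is extreme. Theorem. Let $T$ be a complete affine theory in a Lipschitz language $L$ of arbitrary cardinality. (i) For every $n$ and every non-extreme type $p\in K_n(T)$ there is a (metrically complete) model of $T$ that omits $p$. (ii) There is a single (metrically complete) model $M$ of $T$ that omits every non-extreme type in every $K_n(T)$. In particular $M$ is extremal, so every complete theory has an extremal model. -/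

import Mathlib

open scoped NNReal

universe u v w

namespace AffineLogic

/-- A Lipschitz language: function symbols (those of arity `0` are the constant symbols) and
relation symbols of all arities, each with a Lipschitz constant.
The metric is a logical symbol and is not listed. -/
structure LipschitzLanguage extends FirstOrder.Language.{u, v} where
  /-- The Lipschitz constant of a function symbol. -/
  funLip : ∀ {n : ℕ}, Functions n → ℝ≥0
  /-- The Lipschitz constant of a relation symbol. -/
  relLip : ∀ {n : ℕ}, Relations n → ℝ≥0

/-- Terms with variables from `α`. -/
abbrev LipschitzLanguage.Term (L : LipschitzLanguage.{u, v}) (α : Type w) : Type (max u w) :=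
  L.toLanguage.Term α

/-- A prestructure on a pseudometric space of diameter at most `1`: relations take values in
`[0, 1]`, and all symbols are Lipschitz for the sum metric on tuples. -/
class Prestructure (L : LipschitzLanguage.{u, v}) (M : Type w) [PseudoMetricSpace M] where
  dist_le_one : ∀ a b : M, dist a b ≤ 1
  funMap : ∀ {n : ℕ}, L.Functions n → (Fin n → M) → M
  relMap : ∀ {n : ℕ}, L.Relations n → (Fin n → M) → ℝ
  funMap_lipschitz : ∀ {n : ℕ} (f : L.Functions n) (a b : Fin n → M),
    dist (funMap f a) (funMap f b) ≤ L.funLip f * ∑ i, dist (a i) (b i)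
  relMap_mem : ∀ {n : ℕ} (R : L.Relations n) (a : Fin n → M), relMap R a ∈ Set.Icc (0 : ℝ) 1
  relMap_lipschitz : ∀ {n : ℕ} (R : L.Relations n) (a b : Fin n → M),
    relMap R a - relMap R b ≤ L.relLip R * ∑ i, dist (a i) (b i)

/-- The value of a term under an assignment of its variables. -/
def termValue {L : LipschitzLanguage.{u, v}} {M : Type*} [PseudoMetricSpace M] [Prestructure L M]
    {α : Type w} (a : α → M) : L.Term α → M
  | .var i => a i
  | .func f ts => Prestructure.funMap f (fun i => termValue a (ts i))

/-- Affine formulas with free variables from `α` and from the `n` variables `Fin n`;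
a quantifier binds the last of the latter. -/
inductive BFormula (L : LipschitzLanguage.{u, v}) (α : Type w) : ℕ → Type (max u v w)
  | one {n : ℕ} : BFormula L α n
  | dist {n : ℕ} (t₁ t₂ : L.Term (α ⊕ Fin n)) : BFormula L α n
  | rel {n l : ℕ} (R : L.Relations l) (ts : Fin l → L.Term (α ⊕ Fin n)) : BFormula L α n
  | add {n : ℕ} (φ ψ : BFormula L α n) : BFormula L α n
  | smul {n : ℕ} (r : ℝ) (φ : BFormula L α n) : BFormula L α n
  | inf {n : ℕ} (φ : BFormula L α (n + 1)) : BFormula L α n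
  | sup {n : ℕ} (φ : BFormula L α (n + 1)) : BFormula L α n

/-- The value of a formula. Every formula is bounded on a prestructure, so on a nonempty one the
infima and suprema below are genuine. -/
noncomputable def BFormula.eval {L : LipschitzLanguage.{u, v}} {M : Type*} [PseudoMetricSpace M]
    [Prestructure L M] {α : Type w} (a : α → M) : {n : ℕ} → BFormula L α n → (Fin n → M) → ℝ
  | _, .one, _ => 1
  | _, .dist t₁ t₂, x => Dist.dist (termValue (Sum.elim a x) t₁) (termValue (Sum.elim a x) t₂)
  | _, .rel R ts, x => Prestructure.relMap R (fun i => termValue (Sum.elim a x) (ts i))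
  | _, .add φ ψ, x => φ.eval a x + ψ.eval a x
  | _, .smul r φ, x => r * φ.eval a x
  | _, .inf φ, x => ⨅ b : M, φ.eval a (Fin.snoc x b)
  | _, .sup φ, x => ⨆ b : M, φ.eval a (Fin.snoc x b)

/-- Affine formulas with free variables from `α`. -/
abbrev Formula (L : LipschitzLanguage.{u, v}) (α : Type w) : Type (max u v w) := BFormula L α 0

/-- Affine sentences. -/
abbrev Sentence (L : LipschitzLanguage.{u, v}) : Type (max u v) := Formula L Empty

/-- An `L`-structure: a nonempty prestructure whose (pseudo)metric is a complete metric. -/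
structure Struct (L : LipschitzLanguage.{u, v}) where
  carrier : Type w
  [metricSpace : MetricSpace carrier]
  [completeSpace : CompleteSpace carrier]
  [nonempty : Nonempty carrier]
  [prestructure : Prestructure L carrier]

attribute [instance] Struct.metricSpace Struct.completeSpace Struct.nonempty Struct.prestructure

instance (L : LipschitzLanguage.{u, v}) : CoeSort (Struct.{u, v, w} L) (Type w) := ⟨Struct.carrier⟩

/-- The value `φ^M(a)` of the formula `φ` at the tuple `a`. -/
noncomputable def Formula.value {L : LipschitzLanguage.{u, v}} {M : Type*} [PseudoMetricSpace M]
    [Prestructure L M] {α : Type w} (φ : Formula L α) (a : α → M) : ℝ :=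
  BFormula.eval a φ Fin.elim0

/-- The value `σ^M` of a sentence. -/
noncomputable def Sentence.value {L : LipschitzLanguage.{u, v}} (σ : Sentence L) (M : Type*)
    [PseudoMetricSpace M] [Prestructure L M] : ℝ :=
  Formula.value σ (fun i : Empty => (i.elim : M))

/-- A closed condition `lhs ≤ rhs`. -/
structure ClosedCondition (L : LipschitzLanguage.{u, v}) where
  lhs : Sentence L
  rhs : Sentence L

/-- An affine theory: a set of closed conditions. -/
abbrev Theory (L : LipschitzLanguage.{u, v}) : Type (max u v) := Set (ClosedCondition L)

/-- `M ⊨ T`. -/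
def Theory.HasModel {L : LipschitzLanguage.{u, v}} (T : Theory L) (M : Struct.{u, v, w} L) : Prop :=
  ∀ c ∈ T, Sentence.value c.lhs M ≤ Sentence.value c.rhs M

/-- `T` is complete: it is satisfiable and every sentence is `T`-equivalent to a real number. (By
the downward Löwenheim-Skolem theorem the universe of `L` has enough models to test this.) -/
def Theory.IsComplete {L : LipschitzLanguage.{u, v}} (T : Theory L) : Prop :=
  (∃ M : Struct.{u, v, max u v} L, T.HasModel M) ∧
    ∀ σ : Sentence L, ∃ r : ℝ, ∀ M : Struct.{u, v, max u v} L, T.HasModel M →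
      Sentence.value σ M = r

/-- `T ⊨ 0 ≤ φ`, that is, `φ` is nonnegative at every tuple of every model of `T`. -/
def Theory.Nonneg {L : LipschitzLanguage.{u, v}} (T : Theory L) {α : Type w}
    (φ : Formula L α) : Prop :=
  ∀ M : Struct.{u, v, max u v} L, T.HasModel M → ∀ a : α → M, 0 ≤ φ.value a

/-- The space `K_n(T)` of complete `n`-types, as normalized positive linear functionals on formulas
in `n` free variables. Positivity and linearity force a functional to agree on `T`-equivalent
formulas, so these are the functionals on the space of `T`-equivalence classes of formulas. -/
def Theory.typeSpace {L : LipschitzLanguage.{u, v}} (T : Theory L) (n : ℕ) :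
    Set (Formula L (Fin n) → ℝ) :=
  {p | p .one = 1 ∧ (∀ φ ψ, p (.add φ ψ) = p φ + p ψ) ∧ (∀ (r : ℝ) φ, p (.smul r φ) = r * p φ) ∧
    ∀ φ, T.Nonneg φ → 0 ≤ p φ}

/-- The set `E_n(T)` of extreme `n`-types. -/
def Theory.extremeTypes {L : LipschitzLanguage.{u, v}} (T : Theory L) (n : ℕ) :
    Set (Formula L (Fin n) → ℝ) :=
  Set.extremePoints ℝ (T.typeSpace n)

/-- The type `tp(a)` of a tuple `a` of elements of `M`. -/
noncomputable def tp {L : LipschitzLanguage.{u, v}} {M : Struct.{u, v, w} L} {n : ℕ}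
    (a : Fin n → M) : Formula L (Fin n) → ℝ :=
  fun φ => φ.value a

/-- `M` omits `p` if no tuple of elements of `M` realizes `p`. -/
def Struct.Omits {L : LipschitzLanguage.{u, v}} (M : Struct.{u, v, w} L) {n : ℕ}
    (p : Formula L (Fin n) → ℝ) : Prop :=
  ¬ ∃ a : Fin n → M, ∀ φ, p φ = φ.value a

/-- `M` is extremal for `T`: every finite tuple of elements of `M` has an extreme type. -/
def Struct.IsExtremal {L : LipschitzLanguage.{u, v}} (M : Struct.{u, v, w} L) (T : Theory L) :
    Prop :=
  ∀ (n : ℕ) (a : Fin n → M), tp a ∈ T.extremeTypes n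

end AffineLogic

/-! Everything follows from one extremal model: if every realized type is extreme, every non-extreme
type is omitted at once. The model is built by a Henkin construction in which the complete Henkin
theory is replaced by an extreme point of a compact convex set.

Introduce formal Skolem terms `Wit L`, naming function values and maximizers of formulas, and
consider the types in these terms as variables. The types that respect function names and give every
maximization problem an exact solution form the set `henkinTypes 0`. It is nonempty by compactness,
since suprema can be solved up to any positive error in an actual model. It is a face of the space
of all types, because each defining condition forces a functional that is nonnegative on all types
to vanish (`isExtreme_henkinTypes`). By Krein-Milman it contains an extreme point `q`, which is
extreme among all types. Reading `q` as a table of truth values turns `Wit L` into a prestructure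
(`eval_eq`), whose completion is a model of `T`.

For a tuple `b` of the completion, let `P` be the joint type of all Skolem terms and `b`. If the
type of `b` is `s q₁ + t q₂`, Hahn-Banach lifts this to `P = s P₁ + t P₂` (`exists_decomposition`).
Extremality of `q` makes `P₁` and `P₂` agree with `q` on Skolem terms. Since `s P₁` and `t P₂` are
bounded by `P` on distances, Skolem terms close to `b` under `P` remain close under both parts. So
`q₁` and `q₂` are both limits of the same values of `q`, hence equal (`mem_extremeTypes_of_approx`).
-/

namespace AffineLogic

variable {L : LipschitzLanguage.{u, v}}

/-! ### Renaming, substitution and boundedness of formulas. -/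

section Basics

variable {M : Type*} [PseudoMetricSpace M] [Prestructure L M] {α β : Type*}

theorem termValue_relabel (g : α → β) (b : β → M) (t : L.Term α) :
    termValue b (t.relabel g) = termValue (b ∘ g) t := by
  induction t with
  | var i => rfl
  | func f ts ih => simp only [FirstOrder.Language.Term.relabel, termValue, ih]

/-- The extension of a variable renaming under a quantifier. -/
def liftVar {n m : ℕ} (g : α ⊕ Fin n → β ⊕ Fin m) : α ⊕ Fin (n + 1) → β ⊕ Fin (m + 1) :=
  Sum.elim (fun i => Sum.map id Fin.castSucc (g (.inl i)))
    (Fin.lastCases (.inr (Fin.last m)) fun j => Sum.map id Fin.castSucc (g (.inr j)))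

/-- Renaming of the free variables of a formula. -/
def BFormula.relabel : {n m : ℕ} → (α ⊕ Fin n → β ⊕ Fin m) → BFormula L α n → BFormula L β m
  | _, _, _, .one => .one
  | _, _, g, .dist t₁ t₂ => .dist (t₁.relabel g) (t₂.relabel g)
  | _, _, g, .rel R ts => .rel R fun i => (ts i).relabel g
  | _, _, g, .add φ ψ => .add (φ.relabel g) (ψ.relabel g)
  | _, _, g, .smul r φ => .smul r (φ.relabel g)
  | _, _, g, .inf φ => .inf (φ.relabel (liftVar g))
  | _, _, g, .sup φ => .sup (φ.relabel (liftVar g))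

theorem elim_snoc_map_castSucc {M β : Type*} {m : ℕ} (b : β → M) (y : Fin m → M) (c : M)
    (z : β ⊕ Fin m) :
    Sum.elim b (Fin.snoc (α := fun _ => M) y c) (Sum.map id Fin.castSucc z) = Sum.elim b y z := by
  rcases z with z | z <;> simp

theorem elim_snoc_comp_liftVar_inl {M α β : Type*} {n m : ℕ} (g : α ⊕ Fin n → β ⊕ Fin m) (b : β → M)
    (y : Fin m → M) (c : M) :
    (Sum.elim b (Fin.snoc (α := fun _ => M) y c) ∘ liftVar g) ∘ Sum.inl =
      (Sum.elim b y ∘ g) ∘ Sum.inl := by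
  funext i
  simp [liftVar, elim_snoc_map_castSucc]

theorem elim_snoc_comp_liftVar_inr {M α β : Type*} {n m : ℕ} (g : α ⊕ Fin n → β ⊕ Fin m) (b : β → M)
    (y : Fin m → M) (c : M) :
    (Sum.elim b (Fin.snoc (α := fun _ => M) y c) ∘ liftVar g) ∘ Sum.inr =
      Fin.snoc (α := fun _ => M) ((Sum.elim b y ∘ g) ∘ Sum.inr) c := by
  funext i
  refine Fin.lastCases ?_ (fun j => ?_) i
  · simp [liftVar]
  · simp [liftVar, elim_snoc_map_castSucc]

theorem BFormula.eval_relabel {n : ℕ} (φ : BFormula L α n) : ∀ {m : ℕ}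
    (g : α ⊕ Fin n → β ⊕ Fin m) (b : β → M) (y : Fin m → M), (φ.relabel g).eval b y =
      φ.eval ((Sum.elim b y ∘ g) ∘ Sum.inl) ((Sum.elim b y ∘ g) ∘ Sum.inr) := by
  induction φ with
  | one => intros; rfl
  | dist t₁ t₂ =>
    intros
    simp only [relabel, eval, termValue_relabel, Sum.elim_comp_inl_inr]
  | rel R ts =>
    intros
    simp only [relabel, eval, termValue_relabel, Sum.elim_comp_inl_inr]
  | add φ ψ h₁ h₂ => intros; simp only [relabel, eval, h₁, h₂]
  | smul r φ h => intros; simp only [relabel, eval, h]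
  | inf φ h =>
    intros
    simp only [relabel, eval, h, elim_snoc_comp_liftVar_inl, elim_snoc_comp_liftVar_inr]
  | sup φ h =>
    intros
    simp only [relabel, eval, h, elim_snoc_comp_liftVar_inl, elim_snoc_comp_liftVar_inr]

/-- Renaming of the parameters of a formula without bound variables. -/
def Formula.map (g : α → β) (φ : Formula L α) : Formula L β :=
  BFormula.relabel (Sum.map g id) φ

theorem Formula.value_map (g : α → β) (φ : Formula L α) (b : β → M) :
    (φ.map g).value b = φ.value (b ∘ g) := by
  unfold Formula.map Formula.value
  rw [BFormula.eval_relabel]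
  congr 1

/-- Substitution of free variables for all free variables of a formula. -/
def BFormula.inst {n : ℕ} (φ : BFormula L α n) (a : α → β) (x : Fin n → β) : Formula L β :=
  φ.relabel (Sum.elim (Sum.inl ∘ a) (Sum.inl ∘ x))

theorem BFormula.value_inst {n : ℕ} (φ : BFormula L α n) (a : α → β) (x : Fin n → β)
    (b : β → M) : (φ.inst a x).value b = φ.eval (b ∘ a) (b ∘ x) := by
  unfold BFormula.inst Formula.value
  rw [BFormula.eval_relabel]
  rfl

/-- A bound for the absolute value of a formula. -/
def BFormula.bound : {n : ℕ} → BFormula L α n → ℝ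
  | _, .one => 1
  | _, .dist _ _ => 1
  | _, .rel _ _ => 1
  | _, .add φ ψ => φ.bound + ψ.bound
  | _, .smul r φ => |r| * φ.bound
  | _, .inf φ => φ.bound
  | _, .sup φ => φ.bound

theorem abs_ciSup_le {ι : Type*} [Nonempty ι] {f : ι → ℝ} {B : ℝ} (h : ∀ i, |f i| ≤ B) :
    |⨆ i, f i| ≤ B := by
  have hb : BddAbove (Set.range f) := ⟨B, by rintro _ ⟨i, rfl⟩; exact (abs_le.1 (h i)).2⟩
  obtain ⟨i⟩ := ‹Nonempty ι›
  have : Nonempty ι := ⟨i⟩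
  exact abs_le.2 ⟨(abs_le.1 (h i)).1.trans (le_ciSup hb i), ciSup_le fun i => (abs_le.1 (h i)).2⟩

theorem abs_ciInf_le {ι : Type*} [Nonempty ι] {f : ι → ℝ} {B : ℝ} (h : ∀ i, |f i| ≤ B) :
    |⨅ i, f i| ≤ B := by
  have hb : BddBelow (Set.range f) := ⟨-B, by rintro _ ⟨i, rfl⟩; exact (abs_le.1 (h i)).1⟩
  obtain ⟨i⟩ := ‹Nonempty ι›
  have : Nonempty ι := ⟨i⟩
  exact abs_le.2 ⟨le_ciInf fun i => (abs_le.1 (h i)).1, (ciInf_le hb i).trans (abs_le.1 (h i)).2⟩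

/-- The real infimum is defined as the negated supremum of the negated set, so no boundedness is
needed. Inductions on formulas thereby reduce `inf` to `sup`. -/
theorem BFormula.eval_inf_eq_neg {n : ℕ} (φ : BFormula L α (n + 1)) (a : α → M) (x : Fin n → M) :
    φ.inf.eval a x = -(BFormula.smul (-1) φ).sup.eval a x := by
  simp only [eval, neg_one_mul]
  rw [iInf, Real.sInf_def, iSup]
  congr 2
  ext r
  simp [Set.mem_neg, eq_comm, neg_eq_iff_eq_neg]

variable [Nonempty M]

theorem BFormula.abs_eval_le {n : ℕ} (φ : BFormula L α n) (a : α → M) (x : Fin n → M) :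
    |φ.eval a x| ≤ φ.bound := by
  induction φ with
  | one => simp [eval, bound]
  | dist t₁ t₂ =>
    simp only [eval, bound, abs_dist]
    exact Prestructure.dist_le_one L _ _
  | rel R ts =>
    have := Prestructure.relMap_mem R fun i => termValue (Sum.elim a x) (ts i)
    simp only [eval, bound]
    exact abs_le.2 ⟨by linarith [this.1], this.2⟩
  | add φ ψ h₁ h₂ => exact (abs_add_le _ _).trans (add_le_add (h₁ x) (h₂ x))
  | smul r φ h =>
    simp only [eval, bound, abs_mul]
    exact mul_le_mul_of_nonneg_left (h x) (abs_nonneg r)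
  | inf φ h => exact abs_ciInf_le fun b => h _
  | sup φ h => exact abs_ciSup_le fun b => h _

theorem BFormula.bddAbove_eval_snoc {n : ℕ} (φ : BFormula L α (n + 1)) (a : α → M)
    (x : Fin n → M) : BddAbove (Set.range fun b : M => φ.eval a (Fin.snoc x b)) :=
  ⟨φ.bound, by rintro _ ⟨i, rfl⟩; exact (abs_le.1 (φ.abs_eval_le _ _)).2⟩

theorem BFormula.le_eval_sup {n : ℕ} (φ : BFormula L α (n + 1)) (a : α → M) (x : Fin n → M)
    (b : M) : φ.eval a (Fin.snoc x b) ≤ φ.sup.eval a x :=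
  le_ciSup (φ.bddAbove_eval_snoc a x) b

/-- The supremum of a formula over all its bound variables. -/
def BFormula.supAll : {n : ℕ} → BFormula L α n → Formula L α
  | 0, φ => φ
  | _ + 1, φ => supAll (.sup φ)

theorem BFormula.eval_le_supAll {n : ℕ} (φ : BFormula L α n) (a : α → M) (x : Fin n → M) :
    φ.eval a x ≤ φ.supAll.value a := by
  induction n with
  | zero =>
    rw [Subsingleton.elim x Fin.elim0]
    rfl
  | succ n ih =>
    have := (φ.le_eval_sup a (Fin.init x) (x (Fin.last n))).trans (ih φ.sup _)
    rwa [Fin.snoc_init_self] at this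

theorem BFormula.supAll_le {n : ℕ} (φ : BFormula L α n) (a : α → M) {B : ℝ}
    (h : ∀ x, φ.eval a x ≤ B) : φ.supAll.value a ≤ B := by
  induction n with
  | zero => exact h _
  | succ n ih => exact ih φ.sup fun x => ciSup_le fun b => h _

end Basics

/-! ### Lipschitz continuity of terms and formulas. -/

section Lipschitz

variable {M : Type*} [PseudoMetricSpace M] [Prestructure L M] {α β : Type*}

/-- A Lipschitz constant of a term for the maximum metric. -/
def termLip : L.Term α → ℝ
  | .var _ => 1
  | .func f ts => L.funLip f * ∑ i, termLip (ts i)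

theorem dist_termValue_le (t : L.Term α) {a b : α → M} {δ : ℝ} (h : ∀ i, dist (a i) (b i) ≤ δ) :
    dist (termValue a t) (termValue b t) ≤ termLip t * δ := by
  induction t with
  | var i => simpa [termLip, termValue] using h i
  | func f ts ih =>
    simp only [termLip, termValue]
    refine (Prestructure.funMap_lipschitz f _ _).trans ?_
    rw [mul_assoc, Finset.sum_mul]
    exact mul_le_mul_of_nonneg_left (Finset.sum_le_sum fun i _ => ih i) (L.funLip f).2

/-- A Lipschitz constant of a formula for the maximum metric. -/
def BFormula.lip : {n : ℕ} → BFormula L α n → ℝ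
  | _, .one => 0
  | _, .dist t₁ t₂ => termLip t₁ + termLip t₂
  | _, .rel R ts => L.relLip R * ∑ i, termLip (ts i)
  | _, .add φ ψ => φ.lip + ψ.lip
  | _, .smul r φ => |r| * φ.lip
  | _, .inf φ => φ.lip
  | _, .sup φ => φ.lip

theorem ciSup_sub_le {ι : Type*} [Nonempty ι] {f g : ι → ℝ} {B : ℝ}
    (hg : BddAbove (Set.range g)) (h : ∀ i, |f i - g i| ≤ B) : (⨆ i, f i) - ⨆ i, g i ≤ B := by
  rw [sub_le_iff_le_add]
  refine ciSup_le fun i => ?_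
  linarith [le_ciSup hg i, (abs_le.1 (h i)).2]

theorem abs_ciSup_sub_le {ι : Type*} [Nonempty ι] {f g : ι → ℝ} {B : ℝ}
    (hf : BddAbove (Set.range f)) (hg : BddAbove (Set.range g)) (h : ∀ i, |f i - g i| ≤ B) :
    |(⨆ i, f i) - ⨆ i, g i| ≤ B :=
  abs_sub_le_iff.2 ⟨ciSup_sub_le hg h, ciSup_sub_le hf fun i => by rw [abs_sub_comm]; exact h i⟩

/-- Appending the same element to two tuples does not increase their maximum distance, so
quantifiers keep the Lipschitz constant. -/
theorem BFormula.abs_eval_sub_le [Nonempty M] {n : ℕ} (φ : BFormula L α n) {a b : α → M}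
    {x y : Fin n → M} {δ : ℝ} (h : ∀ i, Dist.dist (a i) (b i) ≤ δ) (h' : ∀ i, Dist.dist (x i) (y i) ≤ δ)
    (hδ : 0 ≤ δ) : |φ.eval a x - φ.eval b y| ≤ φ.lip * δ := by
  have key : ∀ {n : ℕ} {x y : Fin n → M}, (∀ i, Dist.dist (x i) (y i) ≤ δ) →
      ∀ i, Dist.dist (Sum.elim a x i) (Sum.elim b y i) ≤ δ := by
    rintro n x y h' (i | i)
    exacts [h i, h' i]
  have snoc : ∀ {n : ℕ} {x y : Fin n → M}, (∀ i, Dist.dist (x i) (y i) ≤ δ) → ∀ c : M,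
      ∀ i, Dist.dist ((Fin.snoc x c : Fin (n + 1) → M) i) ((Fin.snoc y c : Fin (n + 1) → M) i) ≤ δ := by
    intro n x y h' c i
    refine Fin.lastCases ?_ (fun j => ?_) i
    · simpa using hδ
    · simpa using h' j
  induction φ with
  | one => simp [eval, lip]
  | dist t₁ t₂ =>
    have h₁ := dist_termValue_le t₁ (key h')
    have h₂ := dist_termValue_le t₂ (key h')
    simp only [eval, lip]
    rw [add_mul]
    refine le_trans ?_ (add_le_add h₁ h₂)
    rw [← Real.dist_eq]
    exact dist_dist_dist_le _ _ _ _
  | rel R ts =>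
    have : ∀ {a b : α → M} {x y : Fin _ → M},
        (∀ i, Dist.dist (Sum.elim a x i) (Sum.elim b y i) ≤ δ) →
        (BFormula.rel R ts).eval a x - (BFormula.rel R ts).eval b y ≤
          (BFormula.rel R ts).lip * δ := by
      intro a b x y h
      refine (Prestructure.relMap_lipschitz R _ _).trans ?_
      simp only [lip]
      rw [mul_assoc, Finset.sum_mul]
      exact mul_le_mul_of_nonneg_left
        (Finset.sum_le_sum fun i _ => dist_termValue_le (ts i) h) (L.relLip R).2
    exact abs_sub_le_iff.2 ⟨this (key h'), this fun i => by rw [dist_comm]; exact key h' i⟩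
  | add φ ψ h₁ h₂ =>
    simp only [eval, lip]
    rw [add_sub_add_comm, add_mul]
    exact (abs_add_le _ _).trans (add_le_add (h₁ h') (h₂ h'))
  | smul r φ hi =>
    simp only [eval, lip]
    rw [← mul_sub, abs_mul, mul_assoc]
    exact mul_le_mul_of_nonneg_left (hi h') (abs_nonneg r)
  | sup φ hi =>
    exact abs_ciSup_sub_le (φ.bddAbove_eval_snoc _ _) (φ.bddAbove_eval_snoc _ _)
      fun c => hi (snoc h' c)
  | inf φ hi =>
    rw [eval_inf_eq_neg, eval_inf_eq_neg, neg_sub_neg, abs_sub_comm]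
    refine abs_ciSup_sub_le (bddAbove_eval_snoc _ _ _) (bddAbove_eval_snoc _ _ _) fun c => ?_
    simp only [eval, lip]
    rw [← mul_sub, abs_mul, abs_neg, abs_one, one_mul]
    exact hi (snoc h' c)

theorem Formula.abs_value_sub_le [Nonempty M] (φ : Formula L α) {a b : α → M} {δ : ℝ}
    (h : ∀ i, dist (a i) (b i) ≤ δ) (hδ : 0 ≤ δ) : |φ.value a - φ.value b| ≤ φ.lip * δ :=
  BFormula.abs_eval_sub_le φ h (fun i => i.elim0) hδ

end Lipschitz

/-! ### Finite support of formulas. -/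

section Support

variable {α : Type*}

theorem exists_finset_termValue (t : L.Term α) : ∃ s : Finset α, ∀ (M : Type w)
    [PseudoMetricSpace M] [Prestructure L M] (a b : α → M), (∀ i ∈ s, a i = b i) →
      termValue a t = termValue b t := by
  classical
  induction t with
  | var i => exact ⟨{i}, fun M _ _ a b h => h i (Finset.mem_singleton_self i)⟩
  | func f ts ih =>
    choose s hs using ih
    refine ⟨Finset.univ.biUnion s, fun M _ _ a b h => ?_⟩
    simp only [termValue]
    congr 1
    funext i
    exact hs i M a b fun j hj => h j (Finset.mem_biUnion.2 ⟨i, Finset.mem_univ i, hj⟩)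

theorem exists_finset_termValue_elim {n : ℕ} (t : L.Term (α ⊕ Fin n)) : ∃ s : Finset α,
    ∀ (M : Type w) [PseudoMetricSpace M] [Prestructure L M] (a b : α → M) (x : Fin n → M),
      (∀ i ∈ s, a i = b i) → termValue (Sum.elim a x) t = termValue (Sum.elim b x) t := by
  classical
  obtain ⟨s, hs⟩ := exists_finset_termValue.{u, v, w} t
  refine ⟨s.toLeft, fun M _ _ a b x h => hs M _ _ ?_⟩
  rintro (i | i) hi
  · exact h i (Finset.mem_toLeft.2 hi)
  · rfl

theorem BFormula.exists_finset_eval {n : ℕ} (φ : BFormula L α n) : ∃ s : Finset α,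
    ∀ (M : Type w) [PseudoMetricSpace M] [Prestructure L M] (a b : α → M) (x : Fin n → M),
      (∀ i ∈ s, a i = b i) → φ.eval a x = φ.eval b x := by
  classical
  induction φ with
  | one => exact ⟨∅, fun _ _ _ _ _ _ _ => rfl⟩
  | dist t₁ t₂ =>
    obtain ⟨s₁, h₁⟩ := exists_finset_termValue_elim.{u, v, w} t₁
    obtain ⟨s₂, h₂⟩ := exists_finset_termValue_elim.{u, v, w} t₂
    refine ⟨s₁ ∪ s₂, fun M _ _ a b x h => ?_⟩
    simp only [eval]
    rw [h₁ M a b x fun i hi => h i (Finset.mem_union_left _ hi),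
      h₂ M a b x fun i hi => h i (Finset.mem_union_right _ hi)]
  | rel R ts =>
    choose s hs using fun i => exists_finset_termValue_elim.{u, v, w} (ts i)
    refine ⟨Finset.univ.biUnion s, fun M _ _ a b x h => ?_⟩
    simp only [eval]
    congr 1
    funext i
    exact hs i M a b x fun j hj => h j (Finset.mem_biUnion.2 ⟨i, Finset.mem_univ i, hj⟩)
  | add φ ψ h₁ h₂ =>
    obtain ⟨s₁, h₁⟩ := h₁
    obtain ⟨s₂, h₂⟩ := h₂
    refine ⟨s₁ ∪ s₂, fun M _ _ a b x h => ?_⟩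
    simp only [eval]
    rw [h₁ M a b x fun i hi => h i (Finset.mem_union_left _ hi),
      h₂ M a b x fun i hi => h i (Finset.mem_union_right _ hi)]
  | smul r φ h =>
    obtain ⟨s, hs⟩ := h
    exact ⟨s, fun M _ _ a b x h => congrArg (r * ·) (hs M a b x h)⟩
  | inf φ h =>
    obtain ⟨s, hs⟩ := h
    exact ⟨s, fun M _ _ a b x h => congrArg iInf (funext fun c => hs M a b _ h)⟩
  | sup φ h =>
    obtain ⟨s, hs⟩ := h
    exact ⟨s, fun M _ _ a b x h => congrArg iSup (funext fun c => hs M a b _ h)⟩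

/-- One index beyond the cardinality of `s` absorbs all variables outside `s`; it also covers the
case of empty `s`. -/
theorem exists_fin_retraction [Nonempty α] (s : Finset α) :
    ∃ (k : ℕ) (r : α → Fin k) (e : Fin k → α), ∀ i ∈ s, e (r i) = i := by
  classical
  obtain ⟨i₀⟩ := ‹Nonempty α›
  refine ⟨s.card + 1, fun i => if h : i ∈ s then (s.equivFin ⟨i, h⟩).castSucc else Fin.last _,
    Fin.lastCases i₀ fun j => s.equivFin.symm j, fun i hi => ?_⟩
  simp [hi]

/-- Every formula depends on finitely many variables only. -/
theorem BFormula.exists_fin_eval [Nonempty α] {n : ℕ} (φ : BFormula L α n) :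
    ∃ (k : ℕ) (ψ : BFormula L (Fin k) n) (e : Fin k → α), ∀ (M : Type w) [PseudoMetricSpace M]
      [Prestructure L M] (a : α → M) (x : Fin n → M), φ.eval a x = ψ.eval (a ∘ e) x := by
  obtain ⟨s, hs⟩ := exists_finset_eval.{u, v, w} φ
  obtain ⟨k, r, e, hr⟩ := exists_fin_retraction s
  refine ⟨k, φ.relabel (Sum.map r id), e, fun M _ _ a x => ?_⟩
  rw [eval_relabel]
  exact hs M _ _ _ fun i hi => (congrArg a (hr i hi)).symm

/-- The supremum over arbitrarily many variables of a formula is a formula. -/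
theorem Formula.exists_sup {β : Type*} [Nonempty α] (φ : Formula L (α ⊕ β)) :
    ∃ ψ : Formula L β, ∀ (M : Type w) [PseudoMetricSpace M] [Prestructure L M] [Nonempty M]
      (b : β → M), (∀ a : α → M, φ.value (Sum.elim a b) ≤ ψ.value b) ∧
        ∀ B, (∀ a : α → M, φ.value (Sum.elim a b) ≤ B) → ψ.value b ≤ B := by
  classical
  obtain ⟨s, hs⟩ := BFormula.exists_finset_eval.{u, v, w} φ
  obtain ⟨k, r, e, hr⟩ := exists_fin_retraction s.toLeft
  -- The variables from `α` become `k` bound variables, those outside the support being identified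
  -- with each other; the variables from `β` stay free.
  let φ₀ : BFormula L β k := BFormula.relabel
    (Sum.elim (Sum.elim (fun i => .inr (r i)) .inl) Fin.elim0) φ
  have h₀ : ∀ (M : Type w) [PseudoMetricSpace M] [Prestructure L M] (b : β → M) (x : Fin k → M),
      φ₀.eval b x = φ.value (Sum.elim (x ∘ r) b) := by
    intro M _ _ b x
    simp only [φ₀, BFormula.eval_relabel]
    unfold Formula.value
    congr 1
    · funext i
      rcases i with i | i <;> rfl
    · exact Subsingleton.elim _ _
  refine ⟨φ₀.supAll, fun M _ _ _ b => ⟨fun a => ?_, fun B hB => ?_⟩⟩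
  · have : φ.value (Sum.elim a b) = φ₀.eval b (a ∘ e) := by
      rw [h₀]
      refine hs M _ _ _ ?_
      rintro (i | i) hi
      · exact (congrArg a (hr i (Finset.mem_toLeft.2 hi))).symm
      · rfl
    rw [this]
    exact φ₀.eval_le_supAll b _
  · exact φ₀.supAll_le b fun x => by rw [h₀]; exact hB _

end Support

section Value

variable {M : Type*} [PseudoMetricSpace M] [Prestructure L M] {α : Type*} (a : α → M)

theorem Formula.value_one : Formula.value (L := L) .one a = 1 := rfl

theorem Formula.value_add (φ ψ : Formula L α) :
    Formula.value (.add φ ψ) a = φ.value a + ψ.value a := rfl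

theorem Formula.value_smul (r : ℝ) (φ : Formula L α) :
    Formula.value (.smul r φ) a = r * φ.value a := rfl

/-- The formula `d(x_i, x_j)`. -/
def Formula.varDist (i j : α) : Formula L α := .dist (.var (.inl i)) (.var (.inl j))

theorem Formula.value_varDist (i j : α) :
    (Formula.varDist (L := L) i j).value a = dist (a i) (a j) := rfl

end Value

/-! ### Types in arbitrary sets of variables. -/

namespace Theory

variable {T : Theory L} {α β : Type*}

/-- The space of complete types in an arbitrary set of variables. -/
def types (T : Theory L) (α : Type*) : Set (Formula L α → ℝ) :=
  {p | p .one = 1 ∧ (∀ φ ψ, p (.add φ ψ) = p φ + p ψ) ∧ (∀ (r : ℝ) φ, p (.smul r φ) = r * p φ) ∧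
    ∀ φ, T.Nonneg φ → 0 ≤ p φ}

theorem types_one {p : Formula L α → ℝ} (hp : p ∈ T.types α) : p .one = 1 := hp.1

theorem types_add {p : Formula L α → ℝ} (hp : p ∈ T.types α) (φ ψ : Formula L α) :
    p (.add φ ψ) = p φ + p ψ := hp.2.1 φ ψ

theorem types_smul {p : Formula L α → ℝ} (hp : p ∈ T.types α) (r : ℝ) (φ : Formula L α) :
    p (.smul r φ) = r * p φ := hp.2.2.1 r φ

/-- Positivity applied to `ψ - φ`. Through this lemma, every inequality valid in all models passes
to types. -/
theorem types_mono {p : Formula L α → ℝ} (hp : p ∈ T.types α) {φ ψ : Formula L α}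
    (h : ∀ M : Struct.{u, v, max u v} L, T.HasModel M → ∀ a : α → M, φ.value a ≤ ψ.value a) :
    p φ ≤ p ψ := by
  have := hp.2.2.2 (.add ψ (.smul (-1) φ)) fun M hM a => by
    rw [Formula.value_add, Formula.value_smul]
    linarith [h M hM a]
  rw [types_add hp, types_smul hp] at this
  linarith

theorem types_congr {p : Formula L α → ℝ} (hp : p ∈ T.types α) {φ ψ : Formula L α}
    (h : ∀ M : Struct.{u, v, max u v} L, T.HasModel M → ∀ a : α → M, φ.value a = ψ.value a) :
    p φ = p ψ :=
  le_antisymm (types_mono hp fun M hM a => (h M hM a).le)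
    (types_mono hp fun M hM a => (h M hM a).ge)

theorem types_nonneg {p : Formula L α → ℝ} (hp : p ∈ T.types α) {φ : Formula L α}
    (h : ∀ M : Struct.{u, v, max u v} L, T.HasModel M → ∀ a : α → M, 0 ≤ φ.value a) :
    0 ≤ p φ :=
  hp.2.2.2 φ h

theorem value_mem_types {M : Struct.{u, v, max u v} L} (hM : T.HasModel M) (a : α → M) :
    (fun φ : Formula L α => φ.value a) ∈ T.types α :=
  ⟨rfl, fun _ _ => rfl, fun _ _ => rfl, fun _ h => h M hM a⟩

theorem types_comp_map {p : Formula L β → ℝ} (hp : p ∈ T.types β) (g : α → β) :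
    (fun φ : Formula L α => p (φ.map g)) ∈ T.types α :=
  ⟨types_one hp, fun _ _ => types_add hp _ _, fun _ _ => types_smul hp _ _,
    fun φ h => types_nonneg hp fun M hM a => by rw [Formula.value_map]; exact h M hM _⟩

/-- Linear combinations of formulas are formulas. -/
theorem exists_sum_formula {ι : Type*} (s : Finset ι) (φ : ι → Formula L α) :
    ∃ ψ : Formula L α, (∀ (M : Struct.{u, v, max u v} L) (a : α → M),
      ψ.value a = ∑ i ∈ s, (φ i).value a) ∧ ∀ p ∈ T.types α, p ψ = ∑ i ∈ s, p (φ i) := by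
  classical
  induction s using Finset.induction_on with
  | empty =>
    refine ⟨.smul 0 .one, fun M a => ?_, fun p hp => ?_⟩
    · rw [Formula.value_smul, zero_mul, Finset.sum_empty]
    · rw [types_smul hp, zero_mul, Finset.sum_empty]
  | insert i s hi ih =>
    obtain ⟨ψ, h₁, h₂⟩ := ih
    refine ⟨.add (φ i) ψ, fun M a => ?_, fun p hp => ?_⟩
    · rw [Formula.value_add, h₁, Finset.sum_insert hi]
    · rw [types_add hp, h₂ p hp, Finset.sum_insert hi]

/-- This transfers the Lipschitz inequalities of the symbols from models to types. -/
theorem types_le_mul_sum {p : Formula L α → ℝ} (hp : p ∈ T.types α) {ι : Type*} [Fintype ι]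
    {φ : Formula L α} {ψ : ι → Formula L α} {r : ℝ}
    (h : ∀ M : Struct.{u, v, max u v} L, T.HasModel M → ∀ a : α → M,
      φ.value a ≤ r * ∑ i, (ψ i).value a) : p φ ≤ r * ∑ i, p (ψ i) := by
  obtain ⟨χ, h₁, h₂⟩ := exists_sum_formula (T := T) Finset.univ ψ
  rw [← h₂ p hp, ← types_smul hp]
  exact types_mono hp fun M hM a => by rw [Formula.value_smul, h₁]; exact h M hM a

theorem types_abs_le {p : Formula L α → ℝ} (hp : p ∈ T.types α) (φ : Formula L α) :
    |p φ| ≤ φ.bound := by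
  have h₁ := types_mono hp (φ := φ) (ψ := .smul φ.bound .one) fun M _ a => by
    rw [Formula.value_smul, Formula.value_one, mul_one]
    exact (abs_le.1 (BFormula.abs_eval_le φ a _)).2
  have h₂ := types_mono hp (φ := .smul (-φ.bound) .one) (ψ := φ) fun M _ a => by
    rw [Formula.value_smul, Formula.value_one, mul_one]
    exact (abs_le.1 (BFormula.abs_eval_le φ a _)).1
  rw [types_smul hp, types_one hp, mul_one] at h₁ h₂
  exact abs_le.2 ⟨h₂, h₁⟩

theorem isClosed_types (T : Theory L) (α : Type*) : IsClosed (T.types α) := by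
  simp only [types, Set.ofPred_and, Set.ofPred_forall]
  refine (isClosed_eq (continuous_apply _) continuous_const).inter (IsClosed.inter ?_
    (IsClosed.inter ?_ ?_))
  · exact isClosed_iInter fun φ => isClosed_iInter fun ψ =>
      isClosed_eq (continuous_apply _) ((continuous_apply φ).add (continuous_apply ψ))
  · exact isClosed_iInter fun φ => isClosed_iInter fun ψ =>
      isClosed_eq (continuous_apply _) (continuous_const.mul (continuous_apply _))
  · exact isClosed_iInter fun φ => isClosed_iInter fun _ =>
      isClosed_le continuous_const (continuous_apply _)

/-- Tychonoff: the types form a closed subset of a product of compact intervals. -/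
theorem isCompact_types (T : Theory L) (α : Type*) : IsCompact (T.types α) := by
  refine (isCompact_univ_pi fun φ : Formula L α =>
    isCompact_Icc (a := -φ.bound) (b := φ.bound)).of_isClosed_subset (T.isClosed_types α) ?_
  exact fun p hp φ _ => abs_le.1 (types_abs_le hp φ)

end Theory

/-! ### Skolem terms and approximate witnesses. -/

/-- Formal Skolem terms: a constant for every function application and for every maximization
problem posed by a formula with parameters. -/
inductive Wit (L : LipschitzLanguage.{u, v}) : Type (max u v)
  | func {n : ℕ} (f : L.Functions n) (c : Fin n → Wit L) : Wit L
  | wit {n : ℕ} (φ : BFormula L (Fin n) 1) (c : Fin n → Wit L) : Wit L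

namespace Wit

instance : Nonempty (Wit L) := ⟨.wit (n := 0) .one Fin.elim0⟩

/-- The distance of a function value from the constant that names it. -/
def funDist {n : ℕ} (f : L.Functions n) (c : Fin n → Wit L) : Formula L (Wit L) :=
  .dist (.func f fun i => .var (.inl (c i))) (.var (.inl (.func f c)))

/-- The supremum named by a constant. -/
def supValue {n : ℕ} (φ : BFormula L (Fin n) 1) (c : Fin n → Wit L) : Formula L (Wit L) :=
  (BFormula.sup φ).inst c Fin.elim0

/-- The formula evaluated at its witness. -/
def witValue {n : ℕ} (φ : BFormula L (Fin n) 1) (c : Fin n → Wit L) : Formula L (Wit L) :=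
  φ.inst c fun _ => .wit φ c

/-- The interpretation of Skolem terms with all maximization problems solved up to `ε`. -/
noncomputable def assign (M : Type*) [PseudoMetricSpace M] [Prestructure L M] [Nonempty M]
    (ε : ℝ) : Wit L → M
  | .func f c => Prestructure.funMap f fun i => assign M ε (c i)
  | .wit φ c => Classical.epsilon fun x : M =>
      (BFormula.sup φ).eval (fun i => assign M ε (c i)) Fin.elim0 ≤
        φ.eval (fun i => assign M ε (c i)) (fun _ => x) + ε

section

variable {M : Type*} [PseudoMetricSpace M] [Prestructure L M] {n : ℕ}

theorem value_funDist (f : L.Functions n) (c : Fin n → Wit L) (a : Wit L → M) :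
    (funDist f c).value a = dist (Prestructure.funMap f (a ∘ c)) (a (.func f c)) := rfl

theorem value_supValue (φ : BFormula L (Fin n) 1) (c : Fin n → Wit L) (a : Wit L → M) :
    (supValue φ c).value a = (BFormula.sup φ).eval (a ∘ c) Fin.elim0 := by
  rw [supValue, BFormula.value_inst]
  congr 1
  exact Subsingleton.elim _ _

theorem value_witValue (φ : BFormula L (Fin n) 1) (c : Fin n → Wit L) (a : Wit L → M) :
    (witValue φ c).value a = φ.eval (a ∘ c) (fun _ => a (.wit φ c)) := by
  rw [witValue, BFormula.value_inst]
  rfl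

theorem snoc_elim0 {M : Type*} (x : Fin 0 → M) (b : M) : (Fin.snoc x b : Fin 1 → M) = fun _ => b := by
  funext i
  rw [show i = Fin.last 0 from Subsingleton.elim (α := Fin 1) _ _]
  exact Fin.snoc_last _ _

variable [Nonempty M]

theorem value_witValue_le (φ : BFormula L (Fin n) 1) (c : Fin n → Wit L) (a : Wit L → M) :
    (witValue φ c).value a ≤ (supValue φ c).value a := by
  rw [value_witValue, value_supValue, ← snoc_elim0 Fin.elim0]
  exact φ.le_eval_sup _ _ _

/-- A supremum need not be attained, but for positive `ε` a near-maximizer exists, so the choice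
made in `assign` meets its specification. -/
theorem value_supValue_assign_le (φ : BFormula L (Fin n) 1) (c : Fin n → Wit L) {ε : ℝ}
    (hε : 0 < ε) :
    (supValue φ c).value (assign M ε) ≤ (witValue φ c).value (assign M ε) + ε := by
  rw [value_witValue, value_supValue]
  have : ∃ x : M, (BFormula.sup φ).eval (assign M ε ∘ c) Fin.elim0 ≤
      φ.eval (assign M ε ∘ c) (fun _ => x) + ε := by
    by_contra! h
    have h' : (BFormula.sup φ).eval (assign M ε ∘ c) Fin.elim0 ≤
        (BFormula.sup φ).eval (assign M ε ∘ c) Fin.elim0 - ε :=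
      ciSup_le fun x => by
        rw [snoc_elim0]
        linarith [h x]
    linarith
  have h := Classical.epsilon_spec this
  rw [assign]
  exact h

end

end Wit

/-! ### The face of Henkin types and its extreme points. -/

namespace Theory

variable {T : Theory L}

/-- Types of Skolem terms with all maximization problems solved up to `ε`. -/
def henkinTypes (T : Theory L) (ε : ℝ) : Set (Formula L (Wit L) → ℝ) :=
  {q | q ∈ T.types (Wit L) ∧
    (∀ (n : ℕ) (f : L.Functions n) (c : Fin n → Wit L), q (Wit.funDist f c) = 0) ∧
    ∀ (n : ℕ) (φ : BFormula L (Fin n) 1) (c : Fin n → Wit L),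
      q (Wit.supValue φ c) ≤ q (Wit.witValue φ c) + ε}

theorem isClosed_henkinTypes (T : Theory L) (ε : ℝ) : IsClosed (T.henkinTypes ε) := by
  simp only [henkinTypes, Set.ofPred_and, Set.ofPred_forall]
  refine (T.isClosed_types _).inter (IsClosed.inter ?_ ?_)
  · exact isClosed_iInter fun n => isClosed_iInter fun f => isClosed_iInter fun c =>
      isClosed_eq (continuous_apply _) continuous_const
  · exact isClosed_iInter fun n => isClosed_iInter fun φ => isClosed_iInter fun c =>
      isClosed_le (continuous_apply _) ((continuous_apply _).add continuous_const)

theorem isCompact_henkinTypes (T : Theory L) (ε : ℝ) : IsCompact (T.henkinTypes ε) :=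
  (T.isCompact_types _).of_isClosed_subset (T.isClosed_henkinTypes ε) fun _ h => h.1

theorem henkinTypes_nonempty_of_pos {M : Struct.{u, v, max u v} L} (hM : T.HasModel M) {ε : ℝ}
    (hε : 0 < ε) : (T.henkinTypes ε).Nonempty := by
  refine ⟨fun φ => φ.value (Wit.assign M ε), value_mem_types hM _, fun n f c => ?_,
    fun n φ c => Wit.value_supValue_assign_le φ c hε⟩
  change (Wit.funDist f c).value (Wit.assign M ε) = 0
  rw [Wit.value_funDist, Wit.assign]
  exact dist_self _

theorem henkinTypes_mono {ε δ : ℝ} (h : ε ≤ δ) : T.henkinTypes ε ⊆ T.henkinTypes δ :=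
  fun _ hq => ⟨hq.1, hq.2.1, fun n φ c => (hq.2.2 n φ c).trans (by linarith)⟩

/-- Exact witnesses come from compactness: the sets for errors `1 / (k + 1)` are nested, nonempty
and compact, and a common point has error `0`. -/
theorem henkinTypes_nonempty {M : Struct.{u, v, max u v} L} (hM : T.HasModel M) :
    (T.henkinTypes 0).Nonempty := by
  obtain ⟨q, hq⟩ := IsCompact.nonempty_iInter_of_sequence_nonempty_isCompact_isClosed
    (fun k : ℕ => T.henkinTypes (1 / (k + 1)))
    (fun k => henkinTypes_mono <| one_div_le_one_div_of_le (by positivity) (by push_cast; linarith))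
    (fun k => henkinTypes_nonempty_of_pos hM (by positivity)) (T.isCompact_henkinTypes _)
    (fun k => T.isClosed_henkinTypes _)
  rw [Set.mem_iInter] at hq
  refine ⟨q, (hq 0).1, (hq 0).2.1, fun n φ c => ?_⟩
  refine ge_of_tendsto' (tendsto_const_nhds.add tendsto_one_div_add_atTop_nhds_zero_nat)
    fun k => (hq k).2.2 n φ c

/-- Both `funDist` and `supValue - witValue` are nonnegative on every type. If a convex combination
with positive weights makes such a quantity vanish, each part does. -/
theorem isExtreme_henkinTypes (T : Theory L) :
    IsExtreme ℝ (T.types (Wit L)) (T.henkinTypes 0) := by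
  refine ⟨fun q hq => hq.1, ?_⟩
  rintro p₁ h₁ p₂ h₂ q hq ⟨s, t, hs, ht, -, rfl⟩
  refine ⟨h₁, fun n f c => ?_, fun n φ c => ?_⟩
  · have e₁ := types_nonneg h₁ (φ := Wit.funDist f c) fun M _ a => dist_nonneg
    have e₂ := types_nonneg h₂ (φ := Wit.funDist f c) fun M _ a => dist_nonneg
    have e := hq.2.1 n f c
    simp only [Pi.add_apply, Pi.smul_apply, smul_eq_mul] at e
    have : s * p₁ (Wit.funDist f c) ≤ 0 := by linarith [mul_nonneg ht.le e₂]
    exact le_antisymm (nonpos_of_mul_nonpos_right this hs) e₁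
  · have e₁ := types_mono h₁ fun M _ a => Wit.value_witValue_le φ c a
    have e₂ := types_mono h₂ fun M _ a => Wit.value_witValue_le φ c a
    have e := hq.2.2 n φ c
    simp only [Pi.add_apply, Pi.smul_apply, smul_eq_mul] at e
    have e₃ := mul_le_mul_of_nonneg_left e₂ ht.le
    have : s * p₁ (Wit.supValue φ c) ≤ s * p₁ (Wit.witValue φ c) := by linarith
    linarith [le_of_mul_le_mul_left this hs]

/-- There is an extreme type of Skolem terms in which all maximization problems are solved. -/
theorem exists_extreme_henkinType {M : Struct.{u, v, max u v} L} (hM : T.HasModel M) :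
    ∃ q ∈ T.henkinTypes 0, q ∈ Set.extremePoints ℝ (T.types (Wit L)) := by
  -- Krein-Milman gives an extreme point of the face, and extreme points of a face are extreme in
  -- the whole space.
  obtain ⟨q, hq⟩ := (T.isCompact_henkinTypes 0).extremePoints_nonempty (henkinTypes_nonempty hM)
  exact ⟨q, hq.1, T.isExtreme_henkinTypes.extremePoints_subset_extremePoints hq⟩

end Theory

/-! ### The prestructure on Skolem terms and its truth lemma. -/

namespace Wit

variable {T : Theory L} {q : Formula L (Wit L) → ℝ}

/-- The pseudometric on Skolem terms prescribed by a type. -/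
@[reducible]
noncomputable def pseudoMetricSpace (hq : q ∈ T.henkinTypes 0) : PseudoMetricSpace (Wit L) where
  dist a b := q (Formula.varDist a b)
  dist_self a := by
    have h := Theory.types_congr hq.1 (φ := Formula.varDist a a)
      (ψ := .smul 0 .one) fun M _ b => by
        rw [Formula.value_varDist, dist_self, Formula.value_smul, zero_mul]
    rw [h, Theory.types_smul hq.1, zero_mul]
  dist_comm a b := Theory.types_congr hq.1 fun M _ c => by
    rw [Formula.value_varDist, Formula.value_varDist, dist_comm]
  dist_triangle a b c := by
    rw [← Theory.types_add hq.1]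
    refine Theory.types_mono hq.1 fun M _ d => ?_
    rw [Formula.value_add, Formula.value_varDist, Formula.value_varDist, Formula.value_varDist]
    exact dist_triangle _ _ _

/-- The prestructure on Skolem terms prescribed by a type. -/
@[reducible]
noncomputable def prestructure (hq : q ∈ T.henkinTypes 0) :
    @Prestructure L (Wit L) (pseudoMetricSpace hq) :=
  letI := pseudoMetricSpace hq
  { dist_le_one := fun a b => by
      change q (Formula.varDist a b) ≤ 1
      rw [← Theory.types_one hq.1]
      exact Theory.types_mono hq.1 fun M _ c => Prestructure.dist_le_one L _ _
    funMap := fun f c => Wit.func f c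
    relMap := fun R c => q (.rel R fun i => .var (.inl (c i)))
    funMap_lipschitz := fun {n} f a b => by
      -- The Lipschitz bound is known for the function terms, not for the constants naming their
      -- values. The triangle inequality passes between them, and both `funDist` corrections vanish.
      have h : q (Formula.varDist (Wit.func f a) (Wit.func f b)) ≤
          q (Wit.funDist f a) + (q (Wit.funDist f b) +
            q (.dist (.func f fun i => .var (.inl (a i))) (.func f fun i => .var (.inl (b i))))) := by
        rw [← Theory.types_add hq.1, ← Theory.types_add hq.1]
        refine Theory.types_mono hq.1 fun M _ c => ?_
        rw [Formula.value_add, Formula.value_add, Wit.value_funDist, Wit.value_funDist,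
          Formula.value_varDist, dist_comm (Prestructure.funMap f _) (c (Wit.func f a)),
          add_comm (dist _ _) (Formula.value _ _), ← add_assoc]
        exact dist_triangle4 _ _ _ _
      rw [hq.2.1 n f a, hq.2.1 n f b, zero_add, zero_add] at h
      refine h.trans (Theory.types_le_mul_sum hq.1 fun M _ c => ?_)
      exact Prestructure.funMap_lipschitz f _ _
    relMap_mem := fun R a => by
      refine ⟨Theory.types_nonneg hq.1 fun M _ c => (Prestructure.relMap_mem R _).1, ?_⟩
      rw [← Theory.types_one hq.1]
      exact Theory.types_mono hq.1 fun M _ c => (Prestructure.relMap_mem R _).2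
    relMap_lipschitz := fun R a b => by
      have h : q (.add (.rel R fun i => .var (.inl (a i)))
          (.smul (-1) (.rel R fun i => .var (.inl (b i))))) ≤
            L.relLip R * ∑ i, q (Formula.varDist (a i) (b i)) := by
        refine Theory.types_le_mul_sum hq.1 fun M _ c => ?_
        rw [Formula.value_add, Formula.value_smul, neg_one_mul, ← sub_eq_add_neg]
        exact Prestructure.relMap_lipschitz R _ _
      rw [Theory.types_add hq.1, Theory.types_smul hq.1, neg_one_mul, ← sub_eq_add_neg] at h
      exact h }

theorem elim_comp_inl {α : Type*} {n : ℕ} (a : α → Wit L) (x : Fin n → Wit L) :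
    (Sum.elim (Sum.inl ∘ a) (Sum.inl ∘ x) : α ⊕ Fin n → Wit L ⊕ Fin 0) =
      Sum.inl ∘ Sum.elim a x := by
  funext i
  rcases i with i | i <;> rfl

theorem le_of_mem_henkinTypes (hq : q ∈ T.henkinTypes 0)
    {n : ℕ} (φ : BFormula L (Fin n) 1) (c : Fin n → Wit L) :
    q (Wit.supValue φ c) ≤ q (Wit.witValue φ c) := by
  simpa using hq.2.2 n φ c

section Truth

variable [PseudoMetricSpace (Wit L)] [Prestructure L (Wit L)]

/-- Induction on the term: the Lipschitz bound of `f` carries distance zero from the arguments to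
the application, and the vanishing of `funDist` replaces the application by its name. -/
theorem termValue_spec (hq : q ∈ T.henkinTypes 0)
    (hd : ∀ a b : Wit L, dist a b = q (Formula.varDist a b))
    (hf : ∀ {n : ℕ} (f : L.Functions n) (c : Fin n → Wit L),
      Prestructure.funMap f c = Wit.func f c)
    {α : Type*} (a : α → Wit L) (t : L.Term α) :
    q (.dist (t.relabel (Sum.inl ∘ a))
      (.var (.inl (termValue a t)))) = 0 := by
  refine le_antisymm ?_ (Theory.types_nonneg hq.1 fun M _ c => dist_nonneg)
  induction t with
  | var i => exact ((hd (a i) (a i)).symm.trans (dist_self _)).le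
  | @func n f ts ih =>
    let c : Fin n → Wit L := fun i => termValue a (ts i)
    have hc : termValue a (.func f ts) = Wit.func f c := hf f c
    rw [hc]
    have h₁ : q (.dist ((FirstOrder.Language.Term.func f ts).relabel (Sum.inl ∘ a))
        (.var (.inl (Wit.func f c)))) ≤
        q (.dist (.func f fun i => (ts i).relabel (Sum.inl ∘ a))
          (.func f fun i => .var (.inl (c i)))) + q (Wit.funDist f c) := by
      rw [← Theory.types_add hq.1]
      exact Theory.types_mono hq.1 fun M _ b => dist_triangle _ _ _
    have h₂ : q (.dist (.func f fun i => (ts i).relabel (Sum.inl ∘ a))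
        (.func f fun i => .var (.inl (c i)))) ≤ L.funLip f *
          ∑ i, q (.dist ((ts i).relabel (Sum.inl ∘ a)) (.var (.inl (c i)))) :=
      Theory.types_le_mul_sum hq.1 fun M _ c => Prestructure.funMap_lipschitz f _ _
    rw [hq.2.1 n f c, add_zero] at h₁
    refine h₁.trans (h₂.trans ?_)
    exact mul_nonpos_of_nonneg_of_nonpos (L.funLip f).2 (Finset.sum_nonpos fun i _ => ih i)

/-- Formulas have the values prescribed by the type. -/
theorem eval_eq (hq : q ∈ T.henkinTypes 0)
    (hd : ∀ a b : Wit L, dist a b = q (Formula.varDist a b))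
    (hf : ∀ {n : ℕ} (f : L.Functions n) (c : Fin n → Wit L),
      Prestructure.funMap f c = Wit.func f c)
    (hr : ∀ {n : ℕ} (R : L.Relations n) (c : Fin n → Wit L),
      Prestructure.relMap R c = q (.rel R fun i => .var (.inl (c i))))
    {α : Type*} {n : ℕ} (φ : BFormula L α n) (a : α → Wit L) (x : Fin n → Wit L) :
    BFormula.eval a φ x = q (φ.inst a x) := by
  have sup_case : ∀ {n : ℕ} (φ : BFormula L α (n + 1)) (x : Fin n → Wit L),
      (∀ x, BFormula.eval a φ x = q (φ.inst a x)) →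
      BFormula.eval a φ.sup x = q (φ.sup.inst a x) := by
    intro n φ x ih
    refine le_antisymm (ciSup_le fun c : Wit L => ?_) ?_
    · rw [ih]
      refine Theory.types_mono hq.1 fun M _ b => ?_
      rw [BFormula.value_inst, BFormula.value_inst, Fin.comp_snoc]
      exact φ.le_eval_sup _ _ _
    -- The witness must be a Skolem term, which admits only finitely many parameters. By finite
    -- support `Φ` can be written as `ψ` with parameters `e`, so that `Wit.wit ψ e` attains the
    -- supremum under `q`.
    · let Φ : BFormula L (Wit L) 1 :=
        φ.relabel (liftVar (Sum.elim (Sum.inl ∘ a) (Sum.inl ∘ x)))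
      have hΦ : ∀ (M : Type (max u v)) [PseudoMetricSpace M] [Prestructure L M] (b : Wit L → M)
          (c : M), Φ.eval b (fun _ => c) = φ.eval (b ∘ a) (Fin.snoc (b ∘ x) c) := by
        intro M _ _ b c
        simp only [Φ, BFormula.eval_relabel]
        rw [← Wit.snoc_elim0 Fin.elim0, elim_snoc_comp_liftVar_inl, elim_snoc_comp_liftVar_inr]
        rfl
      obtain ⟨k, ψ, e, hψ⟩ := BFormula.exists_fin_eval.{u, v, max u v} Φ
      have h₁ : q (φ.sup.inst a x) = q (Wit.supValue ψ e) := by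
        refine Theory.types_congr hq.1 fun M _ b => ?_
        rw [BFormula.value_inst, Wit.value_supValue]
        refine congrArg iSup (funext fun c => ?_)
        rw [Wit.snoc_elim0, ← hψ, hΦ]
      have h₂ : q (Wit.witValue ψ e) = q (φ.inst a (Fin.snoc x (Wit.wit ψ e))) := by
        refine Theory.types_congr hq.1 fun M _ b => ?_
        rw [BFormula.value_inst, Wit.value_witValue, ← hψ, hΦ, Fin.comp_snoc]
      rw [h₁]
      refine (le_of_mem_henkinTypes hq ψ e).trans ?_
      rw [h₂, ← ih]
      exact φ.le_eval_sup a x (Wit.wit ψ e)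
  induction φ with
  | one => exact (Theory.types_one hq.1).symm
  | dist t₁ t₂ =>
    have h₁ := termValue_spec hq hd hf (Sum.elim a x) t₁
    have h₂ := termValue_spec hq hd hf (Sum.elim a x) t₂
    simp only [BFormula.inst, BFormula.relabel, BFormula.eval, hd, elim_comp_inl]
    set c₁ : Wit L := termValue (Sum.elim a x) t₁
    set c₂ : Wit L := termValue (Sum.elim a x) t₂
    -- Replacing terms by others at `q`-distance zero does not change `q`-distances.
    have h : ∀ s₁ s₂ s₃ s₄ : L.Term (Wit L ⊕ Fin 0), q (.dist s₁ s₂) = 0 → q (.dist s₃ s₄) = 0 →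
        q (.dist s₁ s₃) ≤ q (.dist s₂ s₄) ∧ q (.dist s₂ s₄) ≤ q (.dist s₁ s₃) := by
      intro s₁ s₂ s₃ s₄ h h'
      constructor
      · have : q (.dist s₁ s₃) ≤ q (.add (.dist s₁ s₂) (.add (.dist s₂ s₄) (.dist s₃ s₄))) := by
          refine Theory.types_mono hq.1 fun M _ b => ?_
          simp only [Formula.value, BFormula.eval]
          rw [← add_assoc, dist_comm (termValue _ s₃) (termValue _ s₄)]
          exact dist_triangle4 _ _ _ _
        rwa [Theory.types_add hq.1, Theory.types_add hq.1, h, h', zero_add, add_zero] at this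
      · have : q (.dist s₂ s₄) ≤ q (.add (.dist s₁ s₂) (.add (.dist s₁ s₃) (.dist s₃ s₄))) := by
          refine Theory.types_mono hq.1 fun M _ b => ?_
          simp only [Formula.value, BFormula.eval]
          rw [← add_assoc, dist_comm (termValue _ s₁) (termValue _ s₂)]
          exact dist_triangle4 _ _ _ _
        rwa [Theory.types_add hq.1, Theory.types_add hq.1, h, h', zero_add, add_zero] at this
    exact le_antisymm (h _ _ _ _ h₁ h₂).2 (h _ _ _ _ h₁ h₂).1
  | @rel n l R ts =>
    simp only [BFormula.inst, BFormula.relabel, BFormula.eval, hr, elim_comp_inl]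
    let c : Fin l → Wit L := fun i => termValue (Sum.elim a x) (ts i)
    let φ₁ : Formula L (Wit L) := .rel R fun i => .var (.inl (c i))
    let φ₂ : Formula L (Wit L) := .rel R fun i => (ts i).relabel (Sum.inl ∘ Sum.elim a x)
    have hs : ∑ i, q (.dist ((ts i).relabel (Sum.inl ∘ Sum.elim a x)) (.var (.inl (c i)))) = 0 :=
      Finset.sum_eq_zero fun i _ => termValue_spec hq hd hf _ _
    have h₁ : q (.add φ₁ (.smul (-1) φ₂)) ≤ L.relLip R *
        ∑ i, q (.dist ((ts i).relabel (Sum.inl ∘ Sum.elim a x)) (.var (.inl (c i)))) := by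
      refine Theory.types_le_mul_sum hq.1 fun M _ b => ?_
      rw [Formula.value_add, Formula.value_smul, neg_one_mul, ← sub_eq_add_neg]
      refine (Prestructure.relMap_lipschitz R _ _).trans_eq ?_
      congr 2
      funext i
      exact dist_comm _ _
    have h₂ : q (.add φ₂ (.smul (-1) φ₁)) ≤ L.relLip R *
        ∑ i, q (.dist ((ts i).relabel (Sum.inl ∘ Sum.elim a x)) (.var (.inl (c i)))) := by
      refine Theory.types_le_mul_sum hq.1 fun M _ b => ?_
      rw [Formula.value_add, Formula.value_smul, neg_one_mul, ← sub_eq_add_neg]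
      exact Prestructure.relMap_lipschitz R _ _
    rw [hs, Theory.types_add hq.1, Theory.types_smul hq.1] at h₁ h₂
    change q φ₁ = q φ₂
    linarith
  | add φ ψ h₁ h₂ =>
    exact (congrArg₂ (· + ·) (h₁ x) (h₂ x)).trans (Theory.types_add hq.1 _ _).symm
  | smul r φ h => exact (congrArg (r * ·) (h x)).trans (Theory.types_smul hq.1 _ _).symm
  | sup φ ih => exact sup_case φ x ih
  | inf φ ih =>
    have h₁ := sup_case (.smul (-1) φ) x fun y =>
      (congrArg ((-1 : ℝ) * ·) (ih y)).trans (Theory.types_smul hq.1 _ _).symm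
    have h₂ : q (φ.inf.inst a x) = q (.smul (-1) ((BFormula.smul (-1) φ).sup.inst a x)) := by
      refine Theory.types_congr hq.1 fun M _ b => ?_
      rw [Formula.value_smul, BFormula.value_inst, BFormula.value_inst, BFormula.eval_inf_eq_neg,
        neg_one_mul]
    rw [BFormula.eval_inf_eq_neg, h₁, h₂, Theory.types_smul hq.1, neg_one_mul]

theorem value_eq (hq : q ∈ T.henkinTypes 0)
    (hd : ∀ a b : Wit L, dist a b = q (Formula.varDist a b))
    (hf : ∀ {n : ℕ} (f : L.Functions n) (c : Fin n → Wit L),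
      Prestructure.funMap f c = Wit.func f c)
    (hr : ∀ {n : ℕ} (R : L.Relations n) (c : Fin n → Wit L),
      Prestructure.relMap R c = q (.rel R fun i => .var (.inl (c i))))
    {α : Type*} (φ : Formula L α) (a : α → Wit L) :
    Formula.value φ a = q (φ.map a) := by
  refine (eval_eq hq hd hf hr φ a _).trans (Theory.types_congr hq.1 fun M _ b => ?_)
  rw [BFormula.value_inst, Formula.value_map]
  exact congrArg _ (Subsingleton.elim _ _)

end Truth

end Wit

/-! ### Completion of a prestructure. -/

section Completion

open UniformSpace

variable {M : Type*} [PseudoMetricSpace M] {n : ℕ}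

theorem isometry_piMap_coe : Isometry
    (Pi.map (fun _ => (↑)) : (Fin n → M) → Fin n → Completion M) := by
  refine Isometry.of_dist_eq fun a b => ?_
  simp only [dist_pi_def, nndist_dist, Pi.map_apply, Completion.dist_eq]

theorem denseRange_piMap_coe :
    DenseRange (Pi.map (fun _ => (↑)) : (Fin n → M) → Fin n → Completion M) :=
  DenseRange.piMap fun _ => Completion.denseRange_coe

theorem exists_completion_extension {N : Type*} [MetricSpace N] [CompleteSpace N]
    {f : (Fin n → M) → N} {K : ℝ≥0} (hf : ∀ a b, dist (f a) (f b) ≤ K * ∑ i, dist (a i) (b i)) :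
    ∃ F : (Fin n → Completion M) → N, (∀ a : Fin n → M, F (fun i => (a i : Completion M)) = f a) ∧
      ∀ a b, dist (F a) (F b) ≤ K * ∑ i, dist (a i) (b i) := by
  have hu : UniformContinuous f := by
    -- The product carries the maximum metric, and the sum metric is at most `n` times it. The
    -- sharper bound in the sum metric is recovered below by density.
    refine (LipschitzWith.of_dist_le_mul (K := K * n) fun a b => (hf a b).trans ?_).uniformContinuous
    rw [NNReal.coe_mul, mul_assoc]
    refine mul_le_mul_of_nonneg_left ?_ K.2
    refine (Finset.sum_le_card_nsmul Finset.univ _ _ fun i _ => dist_le_pi_dist a b i).trans_eq ?_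
    simp
  have hi := (isometry_piMap_coe (M := M) (n := n)).isUniformInducing
  have hd := denseRange_piMap_coe (M := M) (n := n)
  let F := (hi.isDenseInducing hd).extend f
  have hF : Continuous F := (uniformContinuous_uniformly_extend hi hd hu).continuous
  have he : ∀ a : Fin n → M, F (Pi.map (fun _ => (↑)) a) = f a := uniformly_extend_of_ind hi hd hu
  refine ⟨F, he, fun a b => ?_⟩
  refine hd.induction_on₂ (p := fun a b => dist (F a) (F b) ≤ K * ∑ i, dist (a i) (b i)) ?_ ?_ a b
  · exact isClosed_le (by fun_prop) (by fun_prop)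
  · intro a b
    simp only [he, Pi.map_apply, Completion.dist_eq]
    exact hf a b

instance [Nonempty M] : Nonempty (Completion M) := ‹Nonempty M›.map (↑)

variable [Prestructure L M]

theorem exists_funMap_completion (f : L.Functions n) :
    ∃ F : (Fin n → Completion M) → Completion M,
      (∀ a : Fin n → M, F (fun i => (a i : Completion M)) = (Prestructure.funMap f a : M)) ∧
        ∀ a b, dist (F a) (F b) ≤ L.funLip f * ∑ i, dist (a i) (b i) :=
  exists_completion_extension fun a b => by
    rw [Completion.dist_eq]
    exact Prestructure.funMap_lipschitz f a b

theorem exists_relMap_completion (R : L.Relations n) :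
    ∃ F : (Fin n → Completion M) → ℝ,
      (∀ a : Fin n → M, F (fun i => (a i : Completion M)) = Prestructure.relMap R a) ∧
        ∀ a b, dist (F a) (F b) ≤ L.relLip R * ∑ i, dist (a i) (b i) :=
  exists_completion_extension fun a b => by
    rw [Real.dist_eq]
    refine abs_sub_le_iff.2 ⟨Prestructure.relMap_lipschitz R a b, ?_⟩
    simpa only [dist_comm] using Prestructure.relMap_lipschitz R b a

/-- The completion of a prestructure. -/
noncomputable instance : Prestructure L (Completion M) where
  dist_le_one a b := by
    refine Completion.induction_on₂ a b (isClosed_le (by fun_prop) (by fun_prop)) fun a b => ?_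
    rw [Completion.dist_eq]
    exact Prestructure.dist_le_one L a b
  funMap f := (exists_funMap_completion f).choose
  relMap R := (exists_relMap_completion R).choose
  funMap_lipschitz f := (exists_funMap_completion f).choose_spec.2
  relMap_mem R a := by
    have h := (exists_relMap_completion (M := M) R).choose_spec
    have hc : Continuous (exists_relMap_completion (M := M) R).choose := by
      refine continuous_iff_continuousAt.2 fun b => ?_
      refine tendsto_iff_dist_tendsto_zero.2 ?_
      refine squeeze_zero (fun _ => dist_nonneg) (fun a => h.2 a b) ?_
      have : Continuous fun a : Fin _ → Completion M =>
          (L.relLip R : ℝ) * ∑ i, dist (a i) (b i) := by fun_prop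
      simpa using this.tendsto b
    refine denseRange_piMap_coe.induction_on a (isClosed_Icc.preimage hc) fun a => ?_
    exact (h.1 a).symm ▸ Prestructure.relMap_mem R a
  relMap_lipschitz R a b :=
    (le_abs_self _).trans ((exists_relMap_completion R).choose_spec.2 a b)

theorem funMap_coe (f : L.Functions n) (a : Fin n → M) :
    Prestructure.funMap f (fun i => (a i : Completion M)) = (Prestructure.funMap f a : M) :=
  (exists_funMap_completion f).choose_spec.1 a

theorem relMap_coe (R : L.Relations n) (a : Fin n → M) :
    Prestructure.relMap R (fun i => (a i : Completion M)) = Prestructure.relMap R a :=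
  (exists_relMap_completion R).choose_spec.1 a

variable {α : Type*}

theorem termValue_coe (t : L.Term α) (a : α → M) :
    termValue (fun i => (a i : Completion M)) t = (termValue a t : M) := by
  induction t with
  | var i => rfl
  | func f ts ih => simp only [termValue, ih, funMap_coe]

theorem elim_coe {M : Type*} [PseudoMetricSpace M] (a : α → M) (x : Fin n → M) :
    (Sum.elim (fun i => ↑(a i)) (fun i => ↑(x i)) : α ⊕ Fin n → Completion M) =
      fun i => ↑(Sum.elim a x i) := by
  funext i
  rcases i with i | i <;> rfl

theorem snoc_coe {M : Type*} [PseudoMetricSpace M] (x : Fin n → M) (b : M) :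
    (Fin.snoc (fun i => (x i : Completion M)) b : Fin (n + 1) → Completion M) =
      fun i => ((Fin.snoc x b : Fin (n + 1) → M) i : Completion M) := by
  funext i
  refine Fin.lastCases ?_ (fun j => ?_) i <;> simp

theorem BFormula.continuous_eval_snoc {M : Type*} [PseudoMetricSpace M] [Prestructure L M]
    [Nonempty M] (φ : BFormula L α (n + 1)) (a : α → M) (x : Fin n → M) :
    Continuous fun b : M => φ.eval a (Fin.snoc x b) := by
  refine continuous_iff_continuousAt.2 fun c => tendsto_iff_dist_tendsto_zero.2 ?_
  refine squeeze_zero (fun _ => dist_nonneg) (g := fun b => φ.lip * Dist.dist b c) (fun b => ?_) ?_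
  · refine φ.abs_eval_sub_le (fun i => ?_) (fun i => ?_) dist_nonneg
    · rw [dist_self]
      exact dist_nonneg
    · refine Fin.lastCases ?_ (fun j => ?_) i
      · simp
      · simp
  · have : Continuous fun b : M => φ.lip * Dist.dist b c := by fun_prop
    simpa using this.tendsto c

/-- Formulas keep their values in the completion. -/
theorem BFormula.eval_coe [Nonempty M] (φ : BFormula L α n) (a : α → M) (x : Fin n → M) :
    φ.eval (fun i => (a i : Completion M)) (fun i => (x i : Completion M)) = φ.eval a x := by
  have sup_case : ∀ {n : ℕ} (φ : BFormula L α (n + 1)) (x : Fin n → M),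
      (∀ x, φ.eval (fun i => (a i : Completion M)) (fun i => (x i : Completion M)) =
        φ.eval a x) →
      φ.sup.eval (fun i => (a i : Completion M)) (fun i => (x i : Completion M)) =
        φ.sup.eval a x := by
    intro n φ x ih
    -- By continuity, a bound on the dense image of `M` holds on the whole completion; the other
    -- inequality is monotonicity of the supremum.
    refine le_antisymm (ciSup_le fun c => ?_) (ciSup_le fun c => ?_)
    · refine Completion.induction_on c
        (isClosed_le (BFormula.continuous_eval_snoc (M := Completion M) φ _ _)
        continuous_const) fun c => ?_
      rw [snoc_coe, ih]
      exact φ.le_eval_sup a x c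
    · rw [← ih, ← snoc_coe]
      exact φ.le_eval_sup _ _ _
  induction φ with
  | one => rfl
  | dist t₁ t₂ => simp only [eval, elim_coe, termValue_coe, Completion.dist_eq]
  | rel R ts => simp only [eval, elim_coe, termValue_coe, relMap_coe]
  | add φ ψ h₁ h₂ => simp only [eval, h₁, h₂]
  | smul r φ h => simp only [eval, h]
  | sup φ ih => exact sup_case φ x ih
  | inf φ ih =>
    rw [eval_inf_eq_neg, eval_inf_eq_neg, sup_case (.smul (-1) φ) x fun y => congrArg ((-1 : ℝ) * ·) (ih y)]

theorem Formula.value_coe [Nonempty M] (φ : Formula L α) (a : α → M) :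
    φ.value (fun i => (a i : Completion M)) = φ.value a := by
  refine Eq.trans ?_ (BFormula.eval_coe φ a Fin.elim0)
  exact congrArg (BFormula.eval _ φ) (Subsingleton.elim _ _)

end Completion

/-! ### Formulas up to equivalence, and lifting of decompositions by Hahn-Banach. -/

namespace Theory

variable {T : Theory L} {α β : Type*}

/-- Tuples, indexed by `α`, of elements of models of `T`. -/
def Point (T : Theory L) (α : Type*) :=
  Σ M : {M : Struct.{u, v, max u v} L // T.HasModel M}, α → M.1

/-- A formula as a function on the tuples of models of `T`. -/
noncomputable def val (T : Theory L) (φ : Formula L α) : T.Point α → ℝ := fun z => φ.value z.2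

/-- The space of formulas up to `T`-equivalence. -/
def definable (T : Theory L) (α : Type*) : Submodule ℝ (T.Point α → ℝ) where
  carrier := Set.range T.val
  add_mem' := by
    rintro _ _ ⟨φ, rfl⟩ ⟨ψ, rfl⟩
    exact ⟨.add φ ψ, rfl⟩
  zero_mem' := ⟨.smul 0 .one, funext fun z => zero_mul _⟩
  smul_mem' := by
    rintro r _ ⟨φ, rfl⟩
    exact ⟨.smul r φ, rfl⟩

/-- The `T`-equivalence class of a formula. -/
noncomputable def cls (T : Theory L) (φ : Formula L α) : T.definable α := ⟨T.val φ, φ, rfl⟩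

theorem cls_surjective (f : T.definable α) : ∃ φ, T.cls φ = f := by
  obtain ⟨_, φ, rfl⟩ := f
  exact ⟨φ, rfl⟩

theorem cls_add (φ ψ : Formula L α) : T.cls (.add φ ψ) = T.cls φ + T.cls ψ := rfl

theorem cls_smul (r : ℝ) (φ : Formula L α) : T.cls (.smul r φ) = r • T.cls φ := rfl

theorem value_eq_of_cls_eq {φ ψ : Formula L α} (h : T.cls φ = T.cls ψ)
    {M : Struct.{u, v, max u v} L} (hM : T.HasModel M) (a : α → M) : φ.value a = ψ.value a :=
  congrFun (congrArg Subtype.val h) ⟨⟨M, hM⟩, a⟩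

theorem types_eq_of_cls_eq {p : Formula L α → ℝ} (hp : p ∈ T.types α) {φ ψ : Formula L α}
    (h : T.cls φ = T.cls ψ) : p φ = p ψ :=
  types_congr hp fun _ hM a => value_eq_of_cls_eq h hM a

/-- A type is a linear functional on formulas up to equivalence. -/
theorem exists_linearMap {p : Formula L α → ℝ} (hp : p ∈ T.types α) :
    ∃ l : T.definable α →ₗ[ℝ] ℝ, ∀ φ, l (T.cls φ) = p φ := by
  choose r hr using cls_surjective (T := T) (α := α)
  refine ⟨⟨⟨fun f => p (r f), fun f g => ?_⟩, fun c f => ?_⟩, fun φ =>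
    types_eq_of_cls_eq hp (hr _)⟩
  · rw [← types_add hp]
    exact types_eq_of_cls_eq hp (by rw [cls_add, hr, hr, hr])
  · change p (r (c • f)) = c * p (r f)
    rw [← types_smul hp]
    exact types_eq_of_cls_eq hp (by rw [cls_smul, hr, hr])

section Sup

variable [Nonempty α]

/-- The formula that maximizes a given one over all variables in `α`. -/
noncomputable def sup (φ : Formula L (α ⊕ β)) : Formula L β :=
  (Formula.exists_sup.{u, v, max u v} φ).choose

theorem value_le_sup (φ : Formula L (α ⊕ β)) (M : Struct.{u, v, max u v} L) (a : α ⊕ β → M) :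
    φ.value a ≤ (sup φ).value (a ∘ Sum.inr) := by
  have h := ((Formula.exists_sup.{u, v, max u v} φ).choose_spec M (a ∘ Sum.inr)).1 (a ∘ Sum.inl)
  rwa [Sum.elim_comp_inl_inr] at h

theorem sup_le (φ : Formula L (α ⊕ β)) (M : Struct.{u, v, max u v} L) (b : β → M) {B : ℝ}
    (h : ∀ a : α → M, φ.value (Sum.elim a b) ≤ B) : (sup φ).value b ≤ B :=
  ((Formula.exists_sup.{u, v, max u v} φ).choose_spec M b).2 B h

theorem le_value_sup (φ : Formula L (α ⊕ β)) (M : Struct.{u, v, max u v} L) (a : α → M)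
    (b : β → M) : φ.value (Sum.elim a b) ≤ (sup φ).value b :=
  value_le_sup φ M (Sum.elim a b)

theorem types_sup_mono {q : Formula L β → ℝ} (hq : q ∈ T.types β) {φ : Formula L (α ⊕ β)}
    {ψ : Formula L β} (h : ∀ M : Struct.{u, v, max u v} L, T.HasModel M → ∀ (a : α → M)
      (b : β → M), φ.value (Sum.elim a b) ≤ ψ.value b) : q (sup φ) ≤ q ψ :=
  types_mono hq fun M hM b => sup_le φ M b fun a => h M hM a b

theorem types_sup_smul {q : Formula L β → ℝ} (hq : q ∈ T.types β) {r : ℝ} (hr : 0 < r)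
    (φ : Formula L (α ⊕ β)) : q (sup (.smul r φ)) = r * q (sup φ) := by
  rw [← types_smul hq]
  refine types_congr hq fun M hM b => le_antisymm (sup_le _ M b fun a => ?_) ?_
  · exact mul_le_mul_of_nonneg_left (le_value_sup φ M a b) hr.le
  · rw [Formula.value_smul, ← le_div_iff₀' hr]
    refine sup_le _ M b fun a => ?_
    rw [le_div_iff₀' hr]
    exact le_value_sup (.smul r φ) M a b

theorem types_sup_add_le {q : Formula L β → ℝ} (hq : q ∈ T.types β) (φ ψ : Formula L (α ⊕ β)) :
    q (sup (.add φ ψ)) ≤ q (sup φ) + q (sup ψ) := by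
  rw [← types_add hq]
  exact types_sup_mono hq fun M hM a b => add_le_add (le_value_sup φ M a b) (le_value_sup ψ M a b)

/-- The sublinear functional `φ ↦ q (sup φ)` on formulas up to equivalence. -/
theorem exists_sublinear {q : Formula L β → ℝ} (hq : q ∈ T.types β) :
    ∃ N : T.definable (α ⊕ β) → ℝ, (∀ φ, N (T.cls φ) = q (sup φ)) ∧
      (∀ c : ℝ, 0 < c → ∀ f, N (c • f) = c * N f) ∧ ∀ f g, N (f + g) ≤ N f + N g := by
  choose r hr using cls_surjective (T := T) (α := α ⊕ β)
  have key : ∀ φ ψ : Formula L (α ⊕ β), T.cls φ = T.cls ψ → q (sup φ) ≤ q (sup ψ) := by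
    intro φ ψ h
    refine types_sup_mono hq fun M hM a b => ?_
    rw [value_eq_of_cls_eq h hM]
    exact le_value_sup ψ M a b
  have hN : ∀ φ, q (sup (r (T.cls φ))) = q (sup φ) := fun φ =>
    le_antisymm (key _ _ (hr _)) (key _ _ (hr _).symm)
  refine ⟨fun f => q (sup (r f)), hN, fun c hc f => ?_, fun f g => ?_⟩
  · obtain ⟨φ, rfl⟩ := cls_surjective f
    rw [← cls_smul]
    simp only [hN]
    exact types_sup_smul hq hc φ
  · obtain ⟨φ, rfl⟩ := cls_surjective f
    obtain ⟨ψ, rfl⟩ := cls_surjective g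
    rw [← cls_add]
    simp only [hN]
    exact types_sup_add_le hq φ ψ

/-- A linear functional dominated by `q ∘ sup` is a type that extends `q`. -/
theorem mem_types_of_le_sup {q : Formula L β → ℝ} (hq : q ∈ T.types β)
    {P : Formula L (α ⊕ β) → ℝ} (hadd : ∀ φ ψ, P (.add φ ψ) = P φ + P ψ)
    (hsmul : ∀ (r : ℝ) φ, P (.smul r φ) = r * P φ) (h : ∀ φ, P φ ≤ q (sup φ)) :
    P ∈ T.types (α ⊕ β) ∧ ∀ ψ : Formula L β, P (ψ.map Sum.inr) = q ψ := by
  -- Maximizing over variables that do not occur changes nothing; applying this to `-ψ` as well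
  -- gives equality.
  have le : ∀ ψ : Formula L β, P (ψ.map Sum.inr) ≤ q ψ := fun ψ =>
    (h _).trans (types_sup_mono hq fun M _ a b => by rw [Formula.value_map, Sum.elim_comp_inr])
  have eq : ∀ ψ : Formula L β, P (ψ.map Sum.inr) = q ψ := fun ψ => by
    have := le (.smul (-1) ψ)
    rw [types_smul hq, show Formula.map Sum.inr (.smul (-1) ψ : Formula L β) =
      .smul (-1) (ψ.map (Sum.inr (α := α))) from rfl, hsmul] at this
    linarith [le ψ]
  refine ⟨⟨(eq .one).trans (types_one hq), hadd, hsmul, fun φ hφ => ?_⟩, eq⟩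
  have : P (.smul (-1) φ) ≤ q (.smul 0 .one) :=
    (h _).trans (types_sup_mono hq fun M hM a b => by
      rw [Formula.value_smul, Formula.value_smul]
      linarith [hφ M hM (Sum.elim a b)])
  rw [hsmul, types_smul hq] at this
  linarith

/-- A decomposition of the restriction of a type lifts to a decomposition of the type. -/
theorem exists_decomposition {P : Formula L (α ⊕ β) → ℝ} (hP : P ∈ T.types (α ⊕ β))
    {q₁ q₂ : Formula L β → ℝ} (h₁ : q₁ ∈ T.types β) (h₂ : q₂ ∈ T.types β) {s t : ℝ}
    (hs : 0 < s) (ht : 0 < t) (h : ∀ ψ : Formula L β, P (ψ.map Sum.inr) = s * q₁ ψ + t * q₂ ψ) :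
    ∃ P₁ ∈ T.types (α ⊕ β), ∃ P₂ ∈ T.types (α ⊕ β), (∀ ψ : Formula L β, P₁ (ψ.map Sum.inr) = q₁ ψ) ∧
      (∀ ψ : Formula L β, P₂ (ψ.map Sum.inr) = q₂ ψ) ∧ ∀ φ, P φ = s * P₁ φ + t * P₂ φ := by
  obtain ⟨l, hl⟩ := exists_linearMap hP
  obtain ⟨N₁, hN₁, hom₁, add₁⟩ := exists_sublinear (α := α) h₁
  obtain ⟨N₂, hN₂, hom₂, add₂⟩ := exists_sublinear (α := α) h₂
  let D := T.definable (α ⊕ β)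
  -- `P` is placed on the diagonal of `D × D`. An extension `g` to the whole product splits as `g
  -- (x, 0) + g (0, x)`, which is the desired decomposition.
  let f : (D × D) →ₗ.[ℝ] ℝ :=
    ⟨LinearMap.eqLocus (LinearMap.fst ℝ D D) (LinearMap.snd ℝ D D),
      l ∘ₗ LinearMap.fst ℝ D D ∘ₗ Submodule.subtype _⟩
  -- Domination on the diagonal: `P φ ≤ P (sup φ)`, and `sup φ` involves only variables from `β`,
  -- where `P` is `s q₁ + t q₂`.
  have hf : ∀ x : f.domain, f x ≤ s * N₁ x.1.1 + t * N₂ x.1.2 := by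
    rintro ⟨⟨x, y⟩, hxy⟩
    obtain rfl : x = y := hxy
    obtain ⟨φ, rfl⟩ := cls_surjective x
    change l (T.cls φ) ≤ s * N₁ (T.cls φ) + t * N₂ (T.cls φ)
    rw [hl, hN₁, hN₂, ← h]
    exact types_mono hP fun M _ a => by rw [Formula.value_map]; exact value_le_sup φ M a
  obtain ⟨g, hg, hgN⟩ := exists_extension_of_le_sublinear f (fun x => s * N₁ x.1 + t * N₂ x.2)
    (fun c hc x => by
      rw [Prod.smul_fst, Prod.smul_snd, hom₁ c hc, hom₂ c hc]
      ring)
    (fun x y => by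
      have e₁ := mul_le_mul_of_nonneg_left (add₁ x.1 y.1) hs.le
      have e₂ := mul_le_mul_of_nonneg_left (add₂ x.2 y.2) ht.le
      rw [Prod.fst_add, Prod.snd_add]
      linarith) hf
  -- With `N₁ 0 = N₂ 0 = 0`, the bound on `g` at `(x, 0)` and `(0, x)` involves only one of the two
  -- sublinear functionals.
  have z₁ : N₁ 0 = 0 := by
    have := hom₁ 2 two_pos 0
    rw [smul_zero] at this
    linarith
  have z₂ : N₂ 0 = 0 := by
    have := hom₂ 2 two_pos 0
    rw [smul_zero] at this
    linarith
  let l₁ : D →ₗ[ℝ] ℝ := s⁻¹ • (g ∘ₗ LinearMap.inl ℝ D D)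
  let l₂ : D →ₗ[ℝ] ℝ := t⁻¹ • (g ∘ₗ LinearMap.inr ℝ D D)
  have e₁ : ∀ x, g (x, 0) = s * l₁ x := fun x => (mul_inv_cancel_left₀ hs.ne' _).symm
  have e₂ : ∀ x, g (0, x) = t * l₂ x := fun x => (mul_inv_cancel_left₀ ht.ne' _).symm
  obtain ⟨m₁, r₁⟩ := mem_types_of_le_sup (P := fun φ => l₁ (T.cls φ)) h₁
    (fun φ ψ => by rw [cls_add, map_add]) (fun r φ => by rw [cls_smul, map_smul, smul_eq_mul])
    (fun φ => by
      have := hgN (T.cls φ, 0)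
      simp only [e₁, z₂, mul_zero, add_zero, hN₁] at this
      exact le_of_mul_le_mul_left this hs)
  obtain ⟨m₂, r₂⟩ := mem_types_of_le_sup (P := fun φ => l₂ (T.cls φ)) h₂
    (fun φ ψ => by rw [cls_add, map_add]) (fun r φ => by rw [cls_smul, map_smul, smul_eq_mul])
    (fun φ => by
      have := hgN (0, T.cls φ)
      simp only [e₂, z₁, mul_zero, zero_add, hN₂] at this
      exact le_of_mul_le_mul_left this ht)
  refine ⟨_, m₁, _, m₂, r₁, r₂, fun φ => ?_⟩
  have := hg ⟨(T.cls φ, T.cls φ), rfl⟩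
  rw [← e₁, ← e₂, ← map_add, Prod.mk_add_mk, add_zero, zero_add]
  exact (hl φ).symm.trans this.symm

end Sup

/-! ### Extremality of approximated types and the extremal model. -/

/-- A type in finitely many variables that is approximated in metric by extreme types, as seen in
a common extension, is extreme. -/
theorem mem_extremeTypes_of_approx [Nonempty α] {q : Formula L α → ℝ}
    (hq : q ∈ Set.extremePoints ℝ (T.types α)) {n : ℕ} {P : Formula L (α ⊕ Fin n) → ℝ}
    (hP : P ∈ T.types (α ⊕ Fin n)) (hPq : ∀ φ : Formula L α, P (φ.map Sum.inl) = q φ)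
    (happrox : ∀ ε > 0, ∃ a : Fin n → α,
      ∀ i, P (Formula.varDist (.inl (a i)) (.inr i)) ≤ ε) :
    (fun φ : Formula L (Fin n) => P (φ.map Sum.inr)) ∈ T.extremeTypes n := by
  refine ⟨types_comp_map hP Sum.inr, ?_⟩
  rintro q₁ (h₁ : q₁ ∈ T.types (Fin n)) q₂ (h₂ : q₂ ∈ T.types (Fin n)) ⟨s, t, hs, ht, hst, h⟩
  obtain ⟨P₁, m₁, P₂, m₂, r₁, r₂, hdec⟩ := exists_decomposition hP h₁ h₂ hs ht
    fun ψ => (congrFun h ψ).symm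
  -- The restrictions of `P₁` and `P₂` to `α` decompose the extreme type `q`, so both equal `q`.
  have hext := hq.2 (types_comp_map m₁ Sum.inl) (types_comp_map m₂ Sum.inl)
    ⟨s, t, hs, ht, hst, funext fun φ => by rw [← hPq, hdec]; rfl⟩
  have hleft : ∀ φ : Formula L α, P₁ (φ.map Sum.inl) = P₂ (φ.map Sum.inl) := by
    have e₂ : (fun φ : Formula L α => P₂ (φ.map Sum.inl)) = q := by
      refine hq.2 (types_comp_map m₂ Sum.inl) (types_comp_map m₁ Sum.inl)
        ⟨t, s, ht, hs, by rw [add_comm, hst], funext fun φ => ?_⟩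
      rw [← hPq, hdec, add_comm]
      rfl
    exact fun φ => congrFun (hext.trans e₂.symm) φ
  have heq : ∀ φ : Formula L (Fin n), q₁ φ = q₂ φ := by
    intro φ
    -- The maximum of the distances is not an affine formula, so it is bounded by their sum, on
    -- which types can be evaluated.
    have bound : ∀ (a : Fin n → α) {p : Formula L (α ⊕ Fin n) → ℝ}, p ∈ T.types (α ⊕ Fin n) →
        |p (φ.map Sum.inr) - p (φ.map (Sum.inl ∘ a))| ≤
          φ.lip * ∑ i, p (Formula.varDist (.inl (a i)) (.inr i)) := by
      intro a p hp
      have hM : ∀ (M : Struct.{u, v, max u v} L) (b : α ⊕ Fin n → M),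
          |(φ.map Sum.inr).value b - (φ.map (Sum.inl ∘ a)).value b| ≤
            φ.lip * ∑ i, (Formula.varDist (L := L) (.inl (a i)) (.inr i)).value b := by
        intro M b
        rw [Formula.value_map, Formula.value_map]
        refine φ.abs_value_sub_le (fun i => ?_) (Finset.sum_nonneg fun i _ => dist_nonneg)
        rw [dist_comm]
        exact Finset.single_le_sum
          (f := fun i => Dist.dist (b (.inl (a i))) (b (.inr i)))
          (fun i _ => dist_nonneg) (Finset.mem_univ i)
      have e₁ := types_le_mul_sum hp (r := φ.lip)
        (φ := .add (φ.map Sum.inr) (.smul (-1) (φ.map (Sum.inl ∘ a))))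
        (ψ := fun i => Formula.varDist (.inl (a i)) (.inr i)) fun M _ b => by
          rw [Formula.value_add, Formula.value_smul]
          linarith [(abs_le.1 (hM M b)).2]
      have e₂ := types_le_mul_sum hp (r := φ.lip)
        (φ := .add (φ.map (Sum.inl ∘ a)) (.smul (-1) (φ.map Sum.inr)))
        (ψ := fun i => Formula.varDist (.inl (a i)) (.inr i)) fun M _ b => by
          rw [Formula.value_add, Formula.value_smul]
          linarith [(abs_le.1 (hM M b)).1]
      rw [types_add hp, types_smul hp] at e₁ e₂
      exact abs_le.2 ⟨by linarith, by linarith⟩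
    have small : ∀ ε > 0, |q₁ φ - q₂ φ| ≤ |φ.lip| * (n * ε) * (s⁻¹ + t⁻¹) := by
      intro ε hε
      obtain ⟨a, ha⟩ := happrox ε hε
      have hcomp : ∀ {p : Formula L (α ⊕ Fin n) → ℝ}, p ∈ T.types (α ⊕ Fin n) →
          p (φ.map (Sum.inl ∘ a)) = p ((φ.map a).map Sum.inl) := fun hp =>
        types_congr hp fun M _ b => by
          rw [Formula.value_map, Formula.value_map, Formula.value_map]
          rfl
      have e₁ := bound a m₁
      have e₂ := bound a m₂
      rw [r₁, hcomp m₁] at e₁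
      rw [r₂, hcomp m₂, ← hleft] at e₂
      have nonneg : ∀ {p : Formula L (α ⊕ Fin n) → ℝ}, p ∈ T.types (α ⊕ Fin n) → ∀ i,
          0 ≤ p (Formula.varDist (.inl (a i)) (.inr i)) := fun hp i =>
        types_nonneg hp fun M _ b => by
          rw [Formula.value_varDist]
          exact dist_nonneg
      -- `P₂` is nonnegative on distances, so `s P₁ ≤ P ≤ ε` there.
      have d₁ : ∀ i, P₁ (Formula.varDist (.inl (a i)) (.inr i)) ≤ ε * s⁻¹ := by
        intro i
        rw [← div_eq_mul_inv, le_div_iff₀' hs]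
        have := ha i
        rw [hdec] at this
        linarith [mul_nonneg ht.le (nonneg m₂ i)]
      have d₂ : ∀ i, P₂ (Formula.varDist (.inl (a i)) (.inr i)) ≤ ε * t⁻¹ := by
        intro i
        rw [← div_eq_mul_inv, le_div_iff₀' ht]
        have := ha i
        rw [hdec] at this
        linarith [mul_nonneg hs.le (nonneg m₁ i)]
      have sum_le : ∀ {p : Formula L (α ⊕ Fin n) → ℝ} {δ : ℝ}, p ∈ T.types (α ⊕ Fin n) →
          (∀ i, p (Formula.varDist (.inl (a i)) (.inr i)) ≤ δ) →
          φ.lip * ∑ i, p (Formula.varDist (.inl (a i)) (.inr i)) ≤ |φ.lip| * (n * δ) := by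
        intro p δ hp hδ
        refine mul_le_mul (le_abs_self _) ?_ (Finset.sum_nonneg fun i _ => nonneg hp i)
          (abs_nonneg _)
        refine (Finset.sum_le_card_nsmul Finset.univ _ _ fun i _ => hδ i).trans_eq ?_
        simp
      have e₃ := e₁.trans (sum_le m₁ d₁)
      have e₄ := e₂.trans (sum_le m₂ d₂)
      rw [abs_sub_comm] at e₄
      calc |q₁ φ - q₂ φ| ≤ _ := abs_sub_le _ _ _
        _ ≤ _ := add_le_add e₃ e₄
        _ = |φ.lip| * (n * ε) * (s⁻¹ + t⁻¹) := by ring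
    have lim : Filter.Tendsto (fun ε : ℝ => |φ.lip| * (n * ε) * (s⁻¹ + t⁻¹))
        (nhdsWithin 0 (Set.Ioi 0)) (nhds 0) := by
      have : Continuous fun ε : ℝ => |φ.lip| * (n * ε) * (s⁻¹ + t⁻¹) := by fun_prop
      simpa using (this.tendsto 0).mono_left nhdsWithin_le_nhds
    have : |q₁ φ - q₂ φ| ≤ 0 := ge_of_tendsto lim
      (Filter.eventually_of_mem self_mem_nhdsWithin fun ε hε => small ε hε)
    exact sub_eq_zero.1 (abs_nonpos_iff.1 this)
  have : q₁ = q₂ := funext heq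
  subst this
  rw [← h, ← add_smul, hst, one_smul]

open UniformSpace in
/-- Every satisfiable theory has an extremal model. -/
theorem exists_extremal_model {M₀ : Struct.{u, v, max u v} L} (hM₀ : T.HasModel M₀) :
    ∃ M : Struct.{u, v, max u v} L, T.HasModel M ∧ M.IsExtremal T := by
  obtain ⟨q, hq, hext⟩ := exists_extreme_henkinType hM₀
  let _ := Wit.pseudoMetricSpace hq
  let _ := Wit.prestructure hq
  let M : Struct.{u, v, max u v} L := ⟨Completion (Wit L)⟩
  have hval : ∀ φ : Formula L (Wit L),
      φ.value (fun i => (i : Completion (Wit L))) = q φ := fun φ =>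
    (φ.value_coe id).trans <|
      (Wit.value_eq hq (fun _ _ => rfl) (fun _ _ => rfl) (fun _ _ => rfl) φ id).trans <|
        types_congr hq.1 fun N _ a => φ.value_map id a
  have hM : T.HasModel M := by
    intro c hc
    have hs : ∀ σ : Sentence L, Sentence.value σ M = q (Formula.map Empty.elim σ) := by
      intro σ
      rw [← hval, Formula.value_map]
      exact congrArg (Formula.value σ) (Subsingleton.elim _ _)
    rw [hs, hs]
    -- Each condition of `T` holds in all models, hence also for the values prescribed by `q`.
    refine types_mono hq.1 fun N hN a => ?_
    rw [Formula.value_map, Formula.value_map]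
    convert hN c hc using 1 <;> exact congrArg (Formula.value _) (Subsingleton.elim _ _)
  refine ⟨M, hM, fun n b => ?_⟩
  -- The joint assignment of all Skolem terms and `b`; its type extends `q`, and density of the
  -- Skolem terms supplies the approximations of `b`.
  let e : Wit L ⊕ Fin n → M := Sum.elim (fun i => (i : Completion (Wit L))) b
  have h := mem_extremeTypes_of_approx hext (P := fun φ => φ.value e) (value_mem_types hM e)
    (fun φ => by
      rw [Formula.value_map]
      exact hval φ)
    (fun ε hε => by
      have : ∀ i, ∃ a : Wit L, dist (a : Completion (Wit L)) (b i) ≤ ε := by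
        intro i
        obtain ⟨a, ha⟩ := Completion.denseRange_coe.exists_dist_lt (b i) hε
        exact ⟨a, by rw [dist_comm]; exact ha.le⟩
      choose a ha using this
      exact ⟨a, ha⟩)
  convert h using 1
  funext φ
  rw [Formula.value_map]
  rfl

end Theory

end AffineLogic

theorem mainTheorem3 (L : AffineLogic.LipschitzLanguage.{u, v}) (T : AffineLogic.Theory L)
    (hT : T.IsComplete) :
    (∀ (n : ℕ), ∀ p ∈ T.typeSpace n, p ∉ T.extremeTypes n →
      ∃ M : AffineLogic.Struct.{u, v, max u v} L, T.HasModel M ∧ M.Omits p) ∧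
    (∃ M : AffineLogic.Struct.{u, v, max u v} L, T.HasModel M ∧
      (∀ (n : ℕ), ∀ p ∈ T.typeSpace n, p ∉ T.extremeTypes n → M.Omits p) ∧
      M.IsExtremal T) := by
  obtain ⟨⟨M₀, hM₀⟩, -⟩ := hT
  obtain ⟨M, hM, hext⟩ := AffineLogic.Theory.exists_extremal_model hM₀
  have homit : ∀ (n : ℕ), ∀ p ∈ T.typeSpace n, p ∉ T.extremeTypes n → M.Omits p := by
    rintro n p - hp ⟨a, ha⟩
    obtain rfl : p = AffineLogic.tp a := funext ha
    exact hp (hext n a)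
  exact ⟨fun n p hp hp' => ⟨M, hM, homit n p hp hp'⟩, M, hM, homit, hext⟩
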